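/- Let $m,n\ge 1$, let $d_1\ge d_2\ge\dots\ge d_m\ge 1$ be integers with $d_1\le n$, and let $\alpha_1\ge\dots\ge\alpha_n>0$. A $\mathbf d$-design of length $k$ is a family $\Phi=(\mathcal F_j)_{j=1}^m$ of finite sequences $\mathcal F_j=(f_{i,j})_{i=1}^k$ in $\mathbb C^{d_j}$; the frame operator of $\mathcal F_j$ is $S_{\mathcal F_j}=\sum_i f_{i,j}\otimes f_{i,j}$, where $(x\otimes y)z=\langle z,y\rangle x$. Let $\mathcal D(\alpha,\mathbf d)$ be the set of $\mathbf d$-designs of length $n$ with $\sum_{j}\|f_{i,j}\|^2=\alpha_i$ for $1\le i\le n$ (the $(\alpha,\mathbf d)$-designs), with the metric $\sum_j\big(\sum_i\|f_{i,j}-f'_{i,j}\|^2\big)^{1/2}$. Write $\lambda(A)$ or $\lambda^\downarrow(A)$ (respectively $\lambda^\uparrow(A)$) for the vector of eigenvalues of a Hermitian matrix $A$, with multiplicities, in non-increasing (respectively non-decreasing) order, and $x^\downarrow$ for the non-increasing rearrangement of a real vector $x$. Fix a $\mathbf d$-design $\Phi^0=(\mathcal F^0_j)_j$ of any length. Put $\lambda_j=(\lambda_{i,j})_i=\lambda^\downarrow(S_{\mathcal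 F^0_j})$, let $M=\max_j\|S_{\mathcal F_j^0}\|$ (operator norm), and, with the Frobenius norm $\|\cdot\|_2$, let $$\Theta(\Phi)=\sum_{j=1}^m\|S_{\mathcal F_j^0}-S_{\mathcal F_j}\|_2^2,\qquad \Phi\in\mathcal D(\alpha,\mathbf d).$$ There is a $\mathbf d$-design $\tilde\Phi^0=(\tilde{\mathcal F}^0_j)_j$ (of some length) with $S_{\tilde{\mathcal F}_j^0}=M\cdot I_{d_j}-S_{\mathcal F_j^0}$ for all $j$. For any such $\tilde\Phi^0$, consider on $\mathcal D(\alpha,\mathbf d)$ the joint potential $$\Psi(\Phi)=\sum_{j=1}^m\operatorname{tr}\big(S_{(\tilde{\mathcal F}_j^0,\mathcal F_j)}^2\big),\qquad S_{(\tilde{\mathcal F}_j^0,\mathcal F_j)}=S_{\tilde{\mathcal F}_j^0}+S_{\mathcal F_j}.$$ There is exactly one family of vectors $\tilde\nu_j\in\mathbb R^{d_j}$ $(1\le j\le m)$ (the optimal spectra) such that some local minimizer $\Phi$ of $\Psi$ on $\mathcal D(\alpha,\mathbf d)$ satisfies $\lambda(S_{(\tilde{\mathcal F}_j^0,\mathcal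 F_j)})=\tilde\nu_j^{\,\downarrow}$ for every $j$, and whose entries are ordered so that, for some non-increasing $c\in\mathbb R^{d_1}$, $\tilde\nu_{i,j}=\max\big(c_i,\lambda^\uparrow_i(S_{\tilde{\mathcal F}^0_j})\big)$ for all $j$ and $1\le i\le d_j$. Let $\delta_j=(\delta_{i,j})_i=M\,\mathbb 1_{d_j}-\tilde\nu_j$. Then: 1. $\min\{\Theta(\Phi):\Phi\in\mathcal D(\alpha,\mathbf d)\}=\sum_{j}\|\delta_j\|^2$ (the minimum is attained). 2. For $\Phi\in\mathcal D(\alpha,\mathbf d)$, $\Theta(\Phi)=\sum_j\|\delta_j\|^2$ if and only if $\lambda(S_{\mathcal F_j^0}-S_{\mathcal F_j})=\delta_j^\downarrow$ for every $j$. In this case, for each $j$ there is an orthonormal basis $(v_{i,j})_{i=1}^{d_j}$ of $\mathbb C^{d_j}$ such that $$S_{\mathcal F_j^0}=\sum_{i=1}^{d_j}\lambda_{i,j}\,v_{i,j}\otimes v_{i,j}\quad\text{and}\quad S_{\mathcal F_j}=\sum_{i=1}^{d_j}(\lambda_{i,j}-\delta_{i,j})\,v_{i,j}\otimes v_{i,j}.$$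 3. Every local minimizer of $\Theta$ on $\mathcal D(\alpha,\mathbf d)$ is a global minimizer. -/

import Mathlib

namespace MultiDesign

/-- The rank-one matrix `x ⊗ y`, that is `z ↦ ⟪y, z⟫ x`. -/
noncomputable def outer {d : ℕ} (x y : EuclideanSpace ℂ (Fin d)) :
    Matrix (Fin d) (Fin d) ℂ :=
  Matrix.of fun a b => x a * star (y b)

/-- The frame operator `S_F = ∑ i, f_i ⊗ f_i` of a finite sequence in `ℂ^d`. -/
noncomputable def frameOp {d k : ℕ} (F : Fin k → EuclideanSpace ℂ (Fin d)) :
    Matrix (Fin d) (Fin d) ℂ :=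
  ∑ i, outer (F i) (F i)

theorem outer_self_isHermitian {d : ℕ} (x : EuclideanSpace ℂ (Fin d)) :
    (outer x x).IsHermitian := by
  ext a b
  simp [outer, mul_comm]

theorem frameOp_isHermitian {d k : ℕ} (F : Fin k → EuclideanSpace ℂ (Fin d)) :
    (frameOp F).IsHermitian := by
  unfold frameOp Matrix.IsHermitian
  rw [Matrix.conjTranspose_sum]
  exact Finset.sum_congr rfl fun i _ => outer_self_isHermitian (F i)

/-- The eigenvalues of a Hermitian matrix, with multiplicity, in non-increasing order. -/
noncomputable def eigDown {d : ℕ} {A : Matrix (Fin d) (Fin d) ℂ} (hA : A.IsHermitian) :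
    Fin d → ℝ :=
  fun i => hA.eigenvalues₀ (Fin.cast (Fintype.card_fin d).symm i)

/-- The eigenvalues of a Hermitian matrix, with multiplicity, in non-decreasing order. -/
noncomputable def eigUp {d : ℕ} {A : Matrix (Fin d) (Fin d) ℂ} (hA : A.IsHermitian) :
    Fin d → ℝ :=
  fun i => eigDown hA i.rev

/-- The non-increasing rearrangement of a real vector
(the non-decreasing rearrangement read backwards). -/
noncomputable def downSort {d : ℕ} (x : Fin d → ℝ) : Fin d → ℝ :=
  fun i => x (Tuple.sort x i.rev)

/-- The square of the Frobenius norm. -/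
noncomputable def frobSq {d : ℕ} (A : Matrix (Fin d) (Fin d) ℂ) : ℝ :=
  ∑ a, ∑ b, ‖A a b‖ ^ 2

/-- A `d`-design: a family `(F_j)_j` of finite sequences of length `k`, `F_j` in `ℂ^{d_j}`.
It carries the product topology, which is the topology of the metric
`∑ j, (∑ i, ‖f i j - f' i j‖ ^ 2) ^ (1/2)`. -/
abbrev Design {m : ℕ} (d : Fin m → ℕ) (k : ℕ) : Type :=
  (j : Fin m) → Fin k → EuclideanSpace ℂ (Fin (d j))

/-- The set of `(α, d)`-designs. -/
def designs {m n : ℕ} (α : Fin n → ℝ) (d : Fin m → ℕ) : Set (Design d n) :=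
  {Φ | ∀ i, ∑ j, ‖Φ j i‖ ^ 2 = α i}

/-- The (squared) joint frame operator distance to a fixed design. -/
noncomputable def jfod {m k n : ℕ} {d : Fin m → ℕ} (Φ₀ : Design d k) (Φ : Design d n) : ℝ :=
  ∑ j, frobSq (frameOp (Φ₀ j) - frameOp (Φ j))

/-- The multi-completion of a design by another one: append the sequences for each `j`. -/
def completion {m k n : ℕ} {d : Fin m → ℕ} (Φ₀ : Design d k) (Φ : Design d n) :
    Design d (k + n) :=
  fun j => Fin.append (Φ₀ j) (Φ j)

/-- The joint Benedetto-Fickus potential of the multi-completion: the sum over `j` of the traces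
of the squares of the frame operators. -/
noncomputable def jointPotential {m k n : ℕ} {d : Fin m → ℕ} (Φ₀ : Design d k)
    (Φ : Design d n) : ℝ :=
  ∑ j, (frameOp (completion Φ₀ Φ j) * frameOp (completion Φ₀ Φ j)).trace.re

/-- The largest operator norm of the frame operators of a design. -/
noncomputable def maxNorm {m k : ℕ} {d : Fin m → ℕ} (Φ₀ : Design d k) : ℝ :=
  ⨆ j, ‖Matrix.toEuclideanCLM (𝕜 := ℂ) (frameOp (Φ₀ j))‖

/-- `Φt` is a translated design of `Φ₀`: its frame operators are `M I - S_{F_j^0}`, with `M` the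
maximum of the operator norms of the `S_{F_j^0}`. -/
def IsTranslated {m k l : ℕ} {d : Fin m → ℕ} (Φ₀ : Design d k) (Φt : Design d l) : Prop :=
  ∀ j, frameOp (Φt j) =
    ((maxNorm Φ₀ : ℝ) : ℂ) • (1 : Matrix (Fin (d j)) (Fin (d j)) ℂ) - frameOp (Φ₀ j)

/-- `ν = (ν_j)_j` are the optimal spectra of the multi-completion problem with initial design `Φ₀`
and weights `α`: `ν_j` lists the eigenvalues of the frame operator of the `j`-th completed sequence
for a local minimizer of the joint potential on the `(α, d)`-designs. The order in which `ν_j`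
lists them is the one in which `ν_j = max (c, λ↑(S_{F_j^0}))` entrywise for a non-increasing
vector `c` of length `d_1` (truncated to its first `d_j` entries), the same for all `j`. -/
def IsOptimalSpectra {m k n : ℕ} [NeZero m] {d : Fin m → ℕ} (hd : Antitone d) (α : Fin n → ℝ)
    (Φ₀ : Design d k) (ν : (j : Fin m) → Fin (d j) → ℝ) : Prop :=
  (∃ Φ ∈ designs α d, IsLocalMinOn (jointPotential Φ₀) (designs α d) Φ ∧
    ∀ j, eigDown (frameOp_isHermitian (completion Φ₀ Φ j)) = downSort (ν j)) ∧
  ∃ c : Fin (d 0) → ℝ, Antitone c ∧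
    ∀ j i, ν j i =
      max (c (Fin.castLE (hd (Fin.zero_le j)) i)) (eigUp (frameOp_isHermitian (Φ₀ j)) i)

end MultiDesign

namespace MultiDesign

open scoped InnerProductSpace Topology
open Matrix Filter

/-! Write `T_j` for the completed frame operator of block `j` (`totalOp`). For a translated design,
`S_{F_j^0} - S_{F_j} = M I - T_j`. Its squared Frobenius norm is `tr T_j² - 2 M tr T_j + M² d_j`,
and the weights fix the sum over `j` of the traces of `S_{F_j}`. Hence the distance and the
potential differ by a constant on the constraint set, and everything reduces to local minimizers of
the potential.

At such a minimizer three deformations inside the constraint set are tested. Moving `(f_{i,j})_j`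
along a great circle gives `T_j f_{i,j} = c_i f_{i,j}` with `c_i` independent of `j`
(`exists_eigenvalue_of_isLocalMinOn`). Pushing along a linear dependence gives independence of the
`f_{i,j}` with `c_i` above an eigenvalue of `T_j` (`linearIndependent_of_isLocalMinOn`). Rotating
two eigendirections within a block gives a gap between the corresponding eigenvalues of `S_{F_j}`
(`rotation_gap`). Consequently `c` is non-increasing, the two frame operators commute with
oppositely ordered spectra `x` and `y`, and a dimension count yields the water-filling identity `x_i
+ y_i = max (c_i, x_i)` (`structure_of_isLocalMinOn`).

This identity is the optimality condition of a convex quadratic problem in `y`. A trace inequality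
bounds the potential of any competitor below by a function of its spectra `y'`, and majorization of
the weights by `y'` controls the linear term. The result, `jointPotential_add_sum_sq_le`, exceeds
the minimum by the squared distance from `y` to `y'`. So local minimizers are global and all have
the same spectra. Compactness supplies a minimizer, and a counting argument shows that sorted
spectra determine the water-filling order (`eq_of_downSort_eq`). -/

/-! ### Rank-one matrices and frame operators. -/

theorem toEuclideanLin_outer {d : ℕ} (x y z : EuclideanSpace ℂ (Fin d)) :
    (outer x y).toEuclideanLin z = ⟪y, z⟫_ℂ • x := by
  ext a
  simp [outer, Matrix.toLpLin_apply, Matrix.mulVec, dotProduct, PiLp.inner_apply,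
    Finset.sum_mul]
  exact Finset.sum_congr rfl fun i _ => by ring

theorem trace_outer {d : ℕ} (x y : EuclideanSpace ℂ (Fin d)) :
    (outer x y).trace = ⟪y, x⟫_ℂ := by
  simp [outer, Matrix.trace, PiLp.inner_apply]

theorem mul_outer {d : ℕ} (A : Matrix (Fin d) (Fin d) ℂ) (x y : EuclideanSpace ℂ (Fin d)) :
    A * outer x y = outer (A.toEuclideanLin x) y := by
  ext a b
  simp [outer, Matrix.toLpLin_apply, Matrix.mulVec, dotProduct, Matrix.mul_apply,
    Finset.sum_mul, mul_assoc]

theorem trace_mul_outer {d : ℕ} (A : Matrix (Fin d) (Fin d) ℂ)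
    (x y : EuclideanSpace ℂ (Fin d)) :
    (A * outer x y).trace = ⟪y, A.toEuclideanLin x⟫_ℂ := by
  rw [mul_outer, trace_outer]

theorem outer_add_left {d : ℕ} (x x' y : EuclideanSpace ℂ (Fin d)) :
    outer (x + x') y = outer x y + outer x' y := by
  ext a b; simp [outer, add_mul]

theorem outer_add_right {d : ℕ} (x y y' : EuclideanSpace ℂ (Fin d)) :
    outer x (y + y') = outer x y + outer x y' := by
  ext a b; simp [outer, mul_add]

theorem outer_smul_left {d : ℕ} (c : ℂ) (x y : EuclideanSpace ℂ (Fin d)) :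
    outer (c • x) y = c • outer x y := by
  ext a b; simp [outer, mul_assoc]

theorem outer_smul_right {d : ℕ} (c : ℂ) (x y : EuclideanSpace ℂ (Fin d)) :
    outer x (c • y) = star c • outer x y := by
  ext a b; simp [outer]; ring

theorem outer_sum_left {d : ℕ} {ι : Type*} (s : Finset ι) (f : ι → EuclideanSpace ℂ (Fin d))
    (y : EuclideanSpace ℂ (Fin d)) : outer (∑ i ∈ s, f i) y = ∑ i ∈ s, outer (f i) y := by
  ext a b; simp [outer, Finset.sum_mul, Matrix.sum_apply]

theorem outer_sum_right {d : ℕ} {ι : Type*} (s : Finset ι) (f : ι → EuclideanSpace ℂ (Fin d))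
    (y : EuclideanSpace ℂ (Fin d)) : outer y (∑ i ∈ s, f i) = ∑ i ∈ s, outer y (f i) := by
  ext a b; simp [outer, Finset.mul_sum, Matrix.sum_apply]

@[simp] theorem outer_zero_left {d : ℕ} (y : EuclideanSpace ℂ (Fin d)) : outer 0 y = 0 := by
  ext a b; simp [outer]

@[simp] theorem outer_zero_right {d : ℕ} (y : EuclideanSpace ℂ (Fin d)) : outer y 0 = 0 := by
  ext a b; simp [outer]

theorem continuous_outer {d : ℕ} :
    Continuous fun p : EuclideanSpace ℂ (Fin d) × EuclideanSpace ℂ (Fin d) => outer p.1 p.2 := by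
  refine continuous_matrix fun a b => ?_
  simp only [outer, Matrix.of_apply]
  fun_prop

theorem continuous_frameOp {d k : ℕ} :
    Continuous (frameOp : (Fin k → EuclideanSpace ℂ (Fin d)) → _) := by
  unfold frameOp
  refine continuous_finsetSum _ fun i _ => ?_
  exact continuous_outer.comp (by fun_prop : Continuous
    fun F : Fin k → EuclideanSpace ℂ (Fin d) => (F i, F i))

theorem frameOp_completion {m k n : ℕ} {d : Fin m → ℕ} (Φ₀ : Design d k) (Φ : Design d n)
    (j : Fin m) : frameOp (completion Φ₀ Φ j) = frameOp (Φ₀ j) + frameOp (Φ j) := by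
  simp [frameOp, completion, Fin.sum_univ_add]

theorem toEuclideanLin_sum {d : ℕ} {ι : Type*} (s : Finset ι)
    (A : ι → Matrix (Fin d) (Fin d) ℂ) (x : EuclideanSpace ℂ (Fin d)) :
    (∑ i ∈ s, A i).toEuclideanLin x = ∑ i ∈ s, (A i).toEuclideanLin x := by
  rw [map_sum, LinearMap.sum_apply]

theorem toEuclideanLin_frameOp {d k : ℕ} (F : Fin k → EuclideanSpace ℂ (Fin d))
    (x : EuclideanSpace ℂ (Fin d)) :
    (frameOp F).toEuclideanLin x = ∑ i, ⟪F i, x⟫_ℂ • F i := by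
  simp [frameOp, toEuclideanLin_outer]

theorem inner_frameOp {d k : ℕ} (F : Fin k → EuclideanSpace ℂ (Fin d))
    (x : EuclideanSpace ℂ (Fin d)) :
    ⟪x, (frameOp F).toEuclideanLin x⟫_ℂ = ((∑ i, ‖⟪F i, x⟫_ℂ‖ ^ 2 : ℝ) : ℂ) := by
  rw [toEuclideanLin_frameOp, inner_sum]
  push_cast
  refine Finset.sum_congr rfl fun i _ => ?_
  rw [inner_smul_right, ← inner_conj_symm x (F i), Complex.mul_conj']

theorem trace_frameOp {d k : ℕ} (F : Fin k → EuclideanSpace ℂ (Fin d)) :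
    (frameOp F).trace = ((∑ i, ‖F i‖ ^ 2 : ℝ) : ℂ) := by
  simp [frameOp, Matrix.trace_sum, trace_outer, inner_self_eq_norm_sq_to_K]

theorem trace_mul_frameOp {d k : ℕ} (A : Matrix (Fin d) (Fin d) ℂ)
    (F : Fin k → EuclideanSpace ℂ (Fin d)) :
    (A * frameOp F).trace = ∑ i, ⟪F i, A.toEuclideanLin (F i)⟫_ℂ := by
  simp [frameOp, Matrix.mul_sum, Matrix.trace_sum, trace_mul_outer]

/-! ### Spectra, sorting and eigenbases. -/

theorem isSymmetric_of_isHermitian {d : ℕ} {A : Matrix (Fin d) (Fin d) ℂ} (hA : A.IsHermitian) :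
    A.toEuclideanLin.IsSymmetric := Matrix.isSymmetric_toEuclideanLin_iff.mpr hA

/-- A matrix with orthonormal eigenbasis `v` and eigenvalues `x` is `∑ i, x i • v i ⊗ v i`. -/
theorem eq_sum_outer_of_eigen {d : ℕ} {A : Matrix (Fin d) (Fin d) ℂ}
    (v : OrthonormalBasis (Fin d) ℂ (EuclideanSpace ℂ (Fin d))) (x : Fin d → ℝ)
    (h : ∀ i, A.toEuclideanLin (v i) = (x i : ℂ) • v i) :
    A = ∑ i, (x i : ℂ) • outer (v i) (v i) := by
  apply Matrix.toEuclideanLin.injective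
  refine v.toBasis.ext fun i => ?_
  rw [OrthonormalBasis.coe_toBasis, h, toEuclideanLin_sum]
  simp only [map_smul, LinearMap.smul_apply, toEuclideanLin_outer, v.inner_eq_ite]
  simp

theorem trace_eq_sum_of_eigen {d : ℕ} {A : Matrix (Fin d) (Fin d) ℂ}
    (v : OrthonormalBasis (Fin d) ℂ (EuclideanSpace ℂ (Fin d))) (x : Fin d → ℝ)
    (h : ∀ i, A.toEuclideanLin (v i) = (x i : ℂ) • v i) (B : Matrix (Fin d) (Fin d) ℂ) :
    (B * A).trace = ∑ i, (x i : ℂ) * ⟪v i, B.toEuclideanLin (v i)⟫_ℂ := by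
  conv_lhs => rw [eq_sum_outer_of_eigen v x h]
  simp [Matrix.mul_sum, Matrix.trace_sum, trace_mul_outer]

theorem toEuclideanLin_mul {d : ℕ} (A B : Matrix (Fin d) (Fin d) ℂ)
    (x : EuclideanSpace ℂ (Fin d)) :
    (A * B).toEuclideanLin x = A.toEuclideanLin (B.toEuclideanLin x) := by
  simp [Matrix.toLpLin_apply]

theorem trace_sq_of_eigen {d : ℕ} {A : Matrix (Fin d) (Fin d) ℂ}
    (v : OrthonormalBasis (Fin d) ℂ (EuclideanSpace ℂ (Fin d))) (x : Fin d → ℝ)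
    (h : ∀ i, A.toEuclideanLin (v i) = (x i : ℂ) • v i) :
    (A * A).trace.re = ∑ i, x i ^ 2 := by
  rw [trace_eq_sum_of_eigen v x h]
  simp only [h, inner_smul_right, inner_self_eq_norm_sq_to_K, v.norm_eq_one]
  simp [sq]

theorem frobSq_eq_trace {d : ℕ} {A : Matrix (Fin d) (Fin d) ℂ} (hA : A.IsHermitian) :
    frobSq A = (A * A).trace.re := by
  simp only [frobSq, Matrix.trace, Matrix.diag, Matrix.mul_apply, Complex.re_sum]
  refine Finset.sum_congr rfl fun a _ => Finset.sum_congr rfl fun b _ => ?_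
  rw [← hA.apply b a, Complex.star_def, Complex.mul_conj', ← Complex.ofReal_pow, Complex.ofReal_re]

theorem eigDown_antitone {d : ℕ} {A : Matrix (Fin d) (Fin d) ℂ} (hA : A.IsHermitian) :
    Antitone (eigDown hA) := fun _ _ h => hA.eigenvalues₀_antitone (by simpa using h)

theorem downSort_antitone {d : ℕ} (x : Fin d → ℝ) : Antitone (downSort x) :=
  fun _ _ h => Tuple.monotone_sort x (Fin.rev_le_rev.mpr h)

theorem downSort_eq_comp_perm {d : ℕ} (x : Fin d → ℝ) :
    ∃ σ : Equiv.Perm (Fin d), downSort x = x ∘ σ :=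
  ⟨Fin.revPerm.trans (Tuple.sort x), rfl⟩

theorem eq_of_antitone_of_map_eq {d : ℕ} {x y : Fin d → ℝ} (hx : Antitone x) (hy : Antitone y)
    (h : Finset.univ.val.map x = Finset.univ.val.map y) : x = y := by
  have h1 : (List.ofFn x).Perm (List.ofFn y) := by
    rw [← Multiset.coe_eq_coe]
    simpa [Fin.univ_val_map] using h
  exact List.ofFn_injective (h1.eq_of_sortedGE hx.sortedGE_ofFn hy.sortedGE_ofFn)

theorem map_univ_comp_perm {d : ℕ} (x : Fin d → ℝ) (σ : Equiv.Perm (Fin d)) :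
    Finset.univ.val.map (x ∘ σ) = Finset.univ.val.map x := by
  rw [← Multiset.map_map, Multiset.map_univ_val_equiv]

theorem map_downSort {d : ℕ} (x : Fin d → ℝ) :
    Finset.univ.val.map (downSort x) = Finset.univ.val.map x := by
  obtain ⟨σ, hσ⟩ := downSort_eq_comp_perm x
  rw [hσ, map_univ_comp_perm]

theorem downSort_of_antitone {d : ℕ} {x : Fin d → ℝ} (hx : Antitone x) : downSort x = x :=
  eq_of_antitone_of_map_eq (downSort_antitone x) hx (map_downSort x)

theorem map_eigDown {d : ℕ} {A : Matrix (Fin d) (Fin d) ℂ} (hA : A.IsHermitian) :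
    Finset.univ.val.map (fun i => (eigDown hA i : ℂ)) = A.charpoly.roots := by
  rw [hA.roots_charpoly_eq_eigenvalues₀]
  have : (fun i => (eigDown hA i : ℂ)) =
    ((fun i => (hA.eigenvalues₀ i : ℂ)) ∘ (finCongr (Fintype.card_fin d).symm)) := rfl
  rw [this, ← Multiset.map_map, Multiset.map_univ_val_equiv]
  rfl

/-- In the basis `v` the matrix is diagonal, so its characteristic polynomial has the `x i` as roots
with multiplicity. Two non-increasing lists with the same multiset coincide. -/
theorem eigDown_eq_downSort {d : ℕ} {A : Matrix (Fin d) (Fin d) ℂ} (hA : A.IsHermitian)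
    (v : OrthonormalBasis (Fin d) ℂ (EuclideanSpace ℂ (Fin d))) (x : Fin d → ℝ)
    (h : ∀ i, A.toEuclideanLin (v i) = (x i : ℂ) • v i) : eigDown hA = downSort x := by
  refine eq_of_antitone_of_map_eq (eigDown_antitone hA) (downSort_antitone x) ?_
  rw [map_downSort]
  apply Multiset.map_injective Complex.ofReal_injective
  rw [Multiset.map_map, Multiset.map_map]
  refine (map_eigDown hA).trans ?_
  have h1 : LinearMap.toMatrix v.toBasis v.toBasis A.toEuclideanLin =
      Matrix.diagonal fun i => (x i : ℂ) := by
    ext a b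
    rw [LinearMap.toMatrix_apply, OrthonormalBasis.coe_toBasis, h, map_smul, Finsupp.smul_apply,
      OrthonormalBasis.coe_toBasis_repr_apply, v.repr_self, Matrix.diagonal_apply]
    by_cases hab : a = b <;> simp [hab]
  have h2 : A.charpoly = (Matrix.diagonal fun i => (x i : ℂ)).charpoly := by
    rw [← h1, LinearMap.charpoly_toMatrix, Matrix.toEuclideanLin, Matrix.toLpLin_eq_toLin,
      Matrix.charpoly_toLin]
  rw [h2, Matrix.charpoly_diagonal, Polynomial.roots_prod _ _
    (Finset.prod_ne_zero_iff.mpr fun i _ => Polynomial.X_sub_C_ne_zero _)]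
  simp

/-- An orthonormal eigenbasis listing the eigenvalues in non-increasing order. -/
theorem exists_eigDown_basis {d : ℕ} {A : Matrix (Fin d) (Fin d) ℂ} (hA : A.IsHermitian) :
    ∃ v : OrthonormalBasis (Fin d) ℂ (EuclideanSpace ℂ (Fin d)),
      ∀ i, A.toEuclideanLin (v i) = (eigDown hA i : ℂ) • v i := by
  let hs := isSymmetric_of_isHermitian hA
  refine ⟨(hs.eigenvectorBasis finrank_euclideanSpace).reindex (finCongr (Fintype.card_fin d)),
    fun i => ?_⟩
  rw [OrthonormalBasis.reindex_apply]
  exact hs.apply_eigenvectorBasis finrank_euclideanSpace _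

/-- Commuting Hermitian matrices have a common orthonormal eigenbasis. -/
theorem exists_joint_eigenbasis {d : ℕ} {A B : Matrix (Fin d) (Fin d) ℂ} (hA : A.IsHermitian)
    (hB : B.IsHermitian) (hAB : Commute A B) :
    ∃ (v : OrthonormalBasis (Fin d) ℂ (EuclideanSpace ℂ (Fin d))) (x y : Fin d → ℝ),
      ∀ i, A.toEuclideanLin (v i) = (x i : ℂ) • v i ∧ B.toEuclideanLin (v i) = (y i : ℂ) • v i := by
  classical
  have hA' := isSymmetric_of_isHermitian hA
  have hB' := isSymmetric_of_isHermitian hB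
  have hc : Commute A.toEuclideanLin B.toEuclideanLin := by
    refine LinearMap.ext fun z => ?_
    simp only [Module.End.mul_apply, ← toEuclideanLin_mul, hAB.eq]
  have hint := LinearMap.IsSymmetric.directSum_isInternal_of_commute hA' hB' hc
  have hort := LinearMap.IsSymmetric.orthogonalFamily_eigenspace_inf_eigenspace hA' hB'
  set V : ℂ × ℂ → Submodule ℂ (EuclideanSpace ℂ (Fin d)) := fun i =>
    Module.End.eigenspace A.toEuclideanLin i.2 ⊓ Module.End.eigenspace B.toEuclideanLin i.1 with hV
  -- The joint eigenspaces are indexed by the infinite set `ℂ × ℂ`; only finitely many are nonzero,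
  -- and a subordinate basis needs a finite index type.
  have hint' := DirectSum.isInternal_ne_bot_iff.mpr hint
  have hfin := WellFoundedGT.finite_ne_bot_of_iSupIndep hint.submodule_iSupIndep
  have : Fintype {i // V i ≠ ⊥} := hfin.fintype
  have hort' : OrthogonalFamily ℂ (fun i : {i // V i ≠ ⊥} => V i)
    fun i => (V i).subtypeₗᵢ := hort.comp Subtype.val_injective
  let v := hint'.subordinateOrthonormalBasis (n := d) (by simp) hort'
  have hv : ∀ i, ∃ p : ℂ × ℂ, v i ∈ V p := fun i =>
    ⟨_, hint'.subordinateOrthonormalBasis_subordinate (n := d) (by simp) i hort'⟩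
  have real : ∀ {C : Matrix (Fin d) (Fin d) ℂ}, C.IsHermitian → ∀ {i} {c : ℂ},
      v i ∈ Module.End.eigenspace C.toEuclideanLin c →
      C.toEuclideanLin (v i) = (c.re : ℂ) • v i := by
    intro C hC i c hc
    rw [Module.End.mem_eigenspace_iff] at hc
    have h1 := (isSymmetric_of_isHermitian hC) (v i) (v i)
    rw [hc, inner_smul_left, inner_smul_right] at h1
    have h2 : ⟪v i, v i⟫_ℂ = 1 := by simp
    rw [h2, mul_one, mul_one] at h1
    rw [hc, Complex.conj_eq_iff_re.mp h1]
  choose p hp using hv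
  exact ⟨v, fun i => (p i).2.re, fun i => (p i).1.re, fun i =>
    ⟨real hA (hp i).1, real hB (hp i).2⟩⟩

/-- The frame operator of the `j`-th completed sequence. -/
noncomputable def totalOp {m k n : ℕ} {d : Fin m → ℕ} (Φ₀ : Design d k) (Φ : Design d n)
    (j : Fin m) : Matrix (Fin (d j)) (Fin (d j)) ℂ :=
  frameOp (Φ₀ j) + frameOp (Φ j)

theorem totalOp_isHermitian {m k n : ℕ} {d : Fin m → ℕ} (Φ₀ : Design d k) (Φ : Design d n)
    (j : Fin m) : (totalOp Φ₀ Φ j).IsHermitian :=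
  (frameOp_isHermitian _).add (frameOp_isHermitian _)

theorem jointPotential_eq {m k n : ℕ} {d : Fin m → ℕ} (Φ₀ : Design d k) (Φ : Design d n) :
    jointPotential Φ₀ Φ = ∑ j, (totalOp Φ₀ Φ j * totalOp Φ₀ Φ j).trace.re := by
  simp [jointPotential, frameOp_completion, totalOp]

/-- The potential is quadratic in the frame operators, so this expansion is exact. Letting `E`
depend on `s` along a curve absorbs the higher-order terms. -/
theorem jointPotential_perturb {m k n : ℕ} {d : Fin m → ℕ} (Φ₀ : Design d k)
    {Φ Φ' : Design d n} {s : ℝ} {E : (j : Fin m) → Matrix (Fin (d j)) (Fin (d j)) ℂ}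
    (h : ∀ j, frameOp (Φ' j) = frameOp (Φ j) + (s : ℂ) • E j) :
    jointPotential Φ₀ Φ' = jointPotential Φ₀ Φ +
      s * (2 * ∑ j, (totalOp Φ₀ Φ j * E j).trace.re + s * ∑ j, (E j * E j).trace.re) := by
  rw [jointPotential_eq, jointPotential_eq, Finset.mul_sum, Finset.mul_sum,
    ← Finset.sum_add_distrib, Finset.mul_sum, ← Finset.sum_add_distrib]
  refine Finset.sum_congr rfl fun j _ => ?_
  have h1 : totalOp Φ₀ Φ' j = totalOp Φ₀ Φ j + (s : ℂ) • E j := by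
    rw [totalOp, totalOp, h, add_assoc]
  rw [h1, add_mul, mul_add, mul_add, Matrix.trace_add, Matrix.trace_add, Matrix.trace_add,
    smul_mul_assoc, smul_mul_assoc, mul_smul_comm, mul_smul_comm, Matrix.trace_smul,
    Matrix.trace_smul, Matrix.trace_smul, Matrix.trace_smul, Matrix.trace_mul_comm (E j)]
  simp
  ring

/-! ### Deformations of a local minimizer. -/

section Variation

variable {m k n : ℕ} {d : Fin m → ℕ} {α : Fin n → ℝ} {Φ₀ : Design d k} {Φ : Design d n}

theorem eventually_le_of_isLocalMinOn
    (hmin : IsLocalMinOn (jointPotential Φ₀) (designs α d) Φ) {G : ℝ → Design d n}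
    (hG0 : G 0 = Φ) (hGc : Continuous G) (hGD : ∀ᶠ s in 𝓝 0, G s ∈ designs α d) :
    ∀ᶠ s in 𝓝 (0 : ℝ), jointPotential Φ₀ Φ ≤ jointPotential Φ₀ (G s) := by
  have h1 : Tendsto G (𝓝 0) (𝓝[designs α d] Φ) := by
    refine tendsto_nhdsWithin_iff.mpr ⟨?_, hGD⟩
    rw [← hG0]
    exact hGc.tendsto 0
  exact h1.eventually hmin

theorem continuous_sum_trace_mul {A E : ℝ → (j : Fin m) → Matrix (Fin (d j)) (Fin (d j)) ℂ}
    (hA : Continuous A) (hE : Continuous E) :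
    Continuous fun s => ∑ j, (A s j * E s j).trace.re := by
  refine continuous_finsetSum _ fun j _ => Complex.continuous_re.comp ?_
  exact (((continuous_apply j).comp hA).matrix_mul ((continuous_apply j).comp hE)).matrix_trace

/-- The first variation of the joint potential at a local minimizer is non-negative. -/
theorem first_variation
    (hmin : IsLocalMinOn (jointPotential Φ₀) (designs α d) Φ) {G : ℝ → Design d n}
    (hG0 : G 0 = Φ) (hGc : Continuous G) (hGD : ∀ᶠ s in 𝓝 0, G s ∈ designs α d)
    {E : ℝ → (j : Fin m) → Matrix (Fin (d j)) (Fin (d j)) ℂ} (hE : Continuous E)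
    (hGE : ∀ᶠ s in 𝓝 (0 : ℝ), ∀ j, frameOp (G s j) = frameOp (Φ j) + (s : ℂ) • E s j) :
    0 ≤ ∑ j, (totalOp Φ₀ Φ j * E 0 j).trace.re := by
  by_contra! hneg
  -- The potential changes by `s * q s`, and `q 0` is twice the first variation; if that is
  -- negative, small `s > 0` lowers the potential.
  set q : ℝ → ℝ := fun s => 2 * ∑ j, (totalOp Φ₀ Φ j * E s j).trace.re +
    s * ∑ j, (E s j * E s j).trace.re with hq
  have hqc : Continuous q := by
    have h1 := continuous_sum_trace_mul (A := fun _ j => totalOp Φ₀ Φ j) continuous_const hE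
    have h2 := continuous_sum_trace_mul hE hE
    fun_prop
  have hq0 : ∀ᶠ s in 𝓝 (0 : ℝ), q s < 0 :=
    hqc.continuousAt.eventually_lt continuousAt_const (by simp [hq]; linarith)
  have h := (hq0.and (hGE.and (eventually_le_of_isLocalMinOn hmin hG0 hGc hGD)))
  obtain ⟨s, ⟨hs1, hs2, hs3⟩, hs⟩ :=
    ((h.filter_mono nhdsWithin_le_nhds).and (self_mem_nhdsWithin (s := Set.Ioi (0 : ℝ)))).exists
  rw [jointPotential_perturb Φ₀ hs2] at hs3
  have : s * q s < 0 := mul_neg_of_pos_of_neg hs hs1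
  simp only [hq] at this
  linarith

/-- The second variation of the joint potential at a local minimizer is non-negative. -/
theorem second_variation
    (hmin : IsLocalMinOn (jointPotential Φ₀) (designs α d) Φ) {G : ℝ → Design d n}
    (hG0 : G 0 = Φ) (hGc : Continuous G) (hGD : ∀ᶠ s in 𝓝 0, G s ∈ designs α d)
    {E : ℝ → (j : Fin m) → Matrix (Fin (d j)) (Fin (d j)) ℂ} (hE : Continuous E)
    (hGE : ∀ᶠ s in 𝓝 (0 : ℝ), ∀ j, frameOp (G s j) = frameOp (Φ j) + (s : ℂ) • E s j)
    {τ : ℝ} (hτ : ∀ s, ∑ j, (totalOp Φ₀ Φ j * E s j).trace.re = s * τ) :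
    0 ≤ 2 * τ + ∑ j, (E 0 j * E 0 j).trace.re := by
  by_contra! hneg
  -- With the linear trace term equal to `s * τ`, the potential changes by `s ^ 2 * q s`.
  set q : ℝ → ℝ := fun s => 2 * τ + ∑ j, (E s j * E s j).trace.re with hq
  have hqc : Continuous q := by
    have h2 := continuous_sum_trace_mul hE hE
    fun_prop
  have hq0 : ∀ᶠ s in 𝓝 (0 : ℝ), q s < 0 :=
    hqc.continuousAt.eventually_lt continuousAt_const hneg
  have h := (hq0.and (hGE.and (eventually_le_of_isLocalMinOn hmin hG0 hGc hGD)))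
  obtain ⟨s, ⟨hs1, hs2, hs3⟩, hs⟩ :=
    ((h.filter_mono nhdsWithin_le_nhds).and (self_mem_nhdsWithin (s := Set.Ioi (0 : ℝ)))).exists
  rw [jointPotential_perturb Φ₀ hs2, hτ s] at hs3
  have : s * (s * q s) < 0 := mul_neg_of_pos_of_neg hs (mul_neg_of_pos_of_neg hs hs1)
  simp only [hq] at this
  linarith

@[fun_prop]
theorem Continuous.outer {X : Type*} [TopologicalSpace X] {d : ℕ}
    {f g : X → EuclideanSpace ℂ (Fin d)} (hf : Continuous f) (hg : Continuous g) :
    Continuous fun s => outer (f s) (g s) :=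
  continuous_outer.comp (hf.prodMk hg)

theorem frameOp_add_smul {d n : ℕ} (F : Fin n → EuclideanSpace ℂ (Fin d)) (ξ : Fin n → ℂ)
    (p : EuclideanSpace ℂ (Fin d)) :
    frameOp (fun i => F i + ξ i • p) = frameOp F + outer (∑ i, star (ξ i) • F i) p +
      outer p (∑ i, star (ξ i) • F i) + ((∑ i, ‖ξ i‖ ^ 2 : ℝ) : ℂ) • outer p p := by
  simp only [frameOp, outer_sum_left, outer_sum_right]
  push_cast
  rw [Finset.sum_smul, ← Finset.sum_add_distrib, ← Finset.sum_add_distrib,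
    ← Finset.sum_add_distrib]
  refine Finset.sum_congr rfl fun i _ => ?_
  simp only [outer_add_left, outer_add_right, outer_smul_left, outer_smul_right, star_star]
  rw [← Complex.mul_conj', ← Complex.star_def]
  module

theorem inner_totalOp_nonneg {j : Fin m} (x : EuclideanSpace ℂ (Fin (d j))) :
    ∃ r : ℝ, 0 ≤ r ∧ ⟪x, (totalOp Φ₀ Φ j).toEuclideanLin x⟫_ℂ = (r : ℂ) := by
  refine ⟨∑ i, ‖⟪Φ₀ j i, x⟫_ℂ‖ ^ 2 + ∑ i, ‖⟪Φ j i, x⟫_ℂ‖ ^ 2, by positivity, ?_⟩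
  rw [totalOp, map_add, LinearMap.add_apply, inner_add_right, inner_frameOp, inner_frameOp]
  push_cast; rfl

theorem eventually_sq_le_one (κ : ℝ) : ∀ᶠ s in 𝓝 (0 : ℝ), s ^ 2 * κ ≤ 1 := by
  have h : Continuous fun s : ℝ => s ^ 2 * κ := by fun_prop
  exact (h.continuousAt.eventually_lt (continuousAt_const (y := (1 : ℝ))) (by simp)).mono
    fun _ h => h.le

theorem norm_add_sq_eq {d : ℕ} (x y : EuclideanSpace ℂ (Fin d)) :
    ‖x + y‖ ^ 2 = ‖x‖ ^ 2 + 2 * (⟪x, y⟫_ℂ).re + ‖y‖ ^ 2 := norm_add_sq (𝕜 := ℂ) x y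

/-- At a local minimizer, the vectors are eigenvectors of the completed frame operators, and the
eigenvalue does not depend on the block. -/
theorem exists_eigenvalue_of_isLocalMinOn (hα : ∀ i, 0 < α i) (hΦ : Φ ∈ designs α d)
    (hmin : IsLocalMinOn (jointPotential Φ₀) (designs α d) Φ) (i : Fin n) :
    ∃ c : ℝ, 0 ≤ c ∧ ∀ j, (totalOp Φ₀ Φ j).toEuclideanLin (Φ j i) = (c : ℂ) • Φ j i := by
  classical
  choose r hr0 hr using fun j => inner_totalOp_nonneg (Φ₀ := Φ₀) (Φ := Φ) (j := j) (Φ j i)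
  -- The Lagrange multiplier of the constraint on the `i`-th weight: the value that makes the
  -- residual `h` tangent to the sphere, as `hfh0` records.
  set c : ℝ := (∑ j, r j) / α i with hc
  refine ⟨c, div_nonneg (Finset.sum_nonneg fun j _ => hr0 j) (hα i).le, ?_⟩
  set h : (j : Fin m) → EuclideanSpace ℂ (Fin (d j)) := fun j =>
    (totalOp Φ₀ Φ j).toEuclideanLin (Φ j i) - (c : ℂ) • Φ j i with hh
  suffices hN : ∑ j, ‖h j‖ ^ 2 = 0 by
    intro j
    have := (Finset.sum_eq_zero_iff_of_nonneg fun j _ => by positivity).mp hN j (Finset.mem_univ j)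
    exact sub_eq_zero.mp (norm_eq_zero.mp (pow_eq_zero_iff two_ne_zero |>.mp this))
  have hfh : ∀ j, ⟪Φ j i, h j⟫_ℂ = ((r j - c * ‖Φ j i‖ ^ 2 : ℝ) : ℂ) := by
    intro j
    rw [hh]
    simp only [inner_sub_right, inner_smul_right, hr, inner_self_eq_norm_sq_to_K]
    push_cast; rfl
  have hfh0 : ∑ j, (⟪Φ j i, h j⟫_ℂ).re = 0 := by
    simp only [hfh, Complex.ofReal_re, Finset.sum_sub_distrib, ← Finset.mul_sum, hΦ i]
    rw [hc, div_mul_cancel₀ _ (hα i).ne', sub_self]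
  by_contra hN
  have hNpos : 0 < ∑ j, ‖h j‖ ^ 2 :=
    lt_of_le_of_ne (Finset.sum_nonneg fun j _ => by positivity) (Ne.symm hN)
  set N := ∑ j, ‖h j‖ ^ 2 with hNdef
  -- Scales `h` to the radius of the sphere, so that `w s • f - (s * β) • h` runs along a great
  -- circle. The first variation is then `-2 β N`.
  set β : ℝ := √(α i / N) with hβ
  have hβpos : 0 < β := Real.sqrt_pos.mpr (div_pos (hα i) hNpos)
  have hβ2 : β ^ 2 * N = α i := by
    rw [hβ, Real.sq_sqrt (div_pos (hα i) hNpos).le, div_mul_cancel₀ _ hNpos.ne']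
  set w : ℝ → ℝ := fun s => √(1 - s ^ 2) with hw
  have hwc : Continuous w := by fun_prop
  let g : ℝ → (j : Fin m) → EuclideanSpace ℂ (Fin (d j)) := fun s j =>
    ((w s : ℝ) : ℂ) • Φ j i + ((-(s * β) : ℝ) : ℂ) • h j
  let G : ℝ → Design d n := fun s j => Function.update (Φ j) i (g s j)
  let E : ℝ → (j : Fin m) → Matrix (Fin (d j)) (Fin (d j)) ℂ := fun s j =>
    ((-s : ℝ) : ℂ) • outer (Φ j i) (Φ j i) - ((w s * β : ℝ) : ℂ) •
      (outer (Φ j i) (h j) + outer (h j) (Φ j i)) + ((s * β ^ 2 : ℝ) : ℂ) • outer (h j) (h j)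
  have hw2 : ∀ᶠ s in 𝓝 (0 : ℝ), w s ^ 2 = 1 - s ^ 2 :=
    (eventually_sq_le_one 1).mono fun s hs => Real.sq_sqrt (by linarith)
  have key := first_variation (E := E) (G := G) hmin ?_ ?_ ?_ ?_ ?_
  · have hE0 : ∀ j, (totalOp Φ₀ Φ j * E 0 j).trace.re =
        - (2 * β) * (‖h j‖ ^ 2 + c * (⟪Φ j i, h j⟫_ℂ).re) := by
      intro j
      have hT : (totalOp Φ₀ Φ j).toEuclideanLin (Φ j i) = h j + (c : ℂ) • Φ j i := by
        simp [hh]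
      have h1 : ⟪h j, (totalOp Φ₀ Φ j).toEuclideanLin (Φ j i)⟫_ℂ =
          ((‖h j‖ ^ 2 + c * (⟪Φ j i, h j⟫_ℂ).re : ℝ) : ℂ) := by
        rw [hT, inner_add_right, inner_smul_right, inner_self_eq_norm_sq_to_K,
          ← inner_conj_symm (h j), hfh, Complex.conj_ofReal, Complex.ofReal_re]
        push_cast; rfl
      have h2 : ⟪Φ j i, (totalOp Φ₀ Φ j).toEuclideanLin (h j)⟫_ℂ =
          ((‖h j‖ ^ 2 + c * (⟪Φ j i, h j⟫_ℂ).re : ℝ) : ℂ) := by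
        rw [← isSymmetric_of_isHermitian (totalOp_isHermitian Φ₀ Φ j), ← inner_conj_symm, h1,
          Complex.conj_ofReal]
      simp only [E, hw, Complex.ofReal_zero, neg_zero, zero_smul, zero_mul, zero_sub, add_zero,
        mul_neg, mul_smul_comm, mul_add, Matrix.trace_neg, Matrix.trace_smul, Matrix.trace_add,
        trace_mul_outer, h1, h2]
      simp [-Complex.ofReal_add, ← Complex.ofReal_add, -Complex.ofReal_mul, -Complex.ofReal_pow]
      ring
    rw [Finset.sum_congr rfl fun j _ => hE0 j, ← Finset.mul_sum, Finset.sum_add_distrib,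
      ← Finset.mul_sum, hfh0] at key
    nlinarith
  · funext j
    simp [G, g, hw]
  · refine continuous_pi fun j => Continuous.update continuous_const i ?_
    fun_prop
  · filter_upwards [hw2] with s hs i'
    by_cases hi : i' = i
    · subst hi
      have h1 : ∀ j, ‖G s j i'‖ ^ 2 = w s ^ 2 * ‖Φ j i'‖ ^ 2 -
          2 * w s * s * β * (⟪Φ j i', h j⟫_ℂ).re + s ^ 2 * β ^ 2 * ‖h j‖ ^ 2 := by
        intro j
        simp only [G, g, Function.update_self, norm_add_sq_eq, inner_smul_left,
          inner_smul_right, norm_smul, Complex.norm_real, Real.norm_eq_abs, mul_pow, sq_abs,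
          Complex.conj_ofReal, ← mul_assoc, ← Complex.ofReal_mul, Complex.re_ofReal_mul]
        ring
      simp only [h1, Finset.sum_add_distrib, Finset.sum_sub_distrib, ← Finset.mul_sum, hfh0]
      rw [hΦ i', hs, ← hNdef, mul_assoc (s ^ 2), hβ2]
      ring
    · simp only [G, Function.update_of_ne hi]
      exact hΦ i'
  · refine continuous_pi fun j => ?_
    fun_prop
  · filter_upwards [hw2] with s hs j
    have hup : frameOp (G s j) = frameOp (Φ j) + (outer (g s j) (g s j) -
        outer (Φ j i) (Φ j i)) := by
      simp only [frameOp, G]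
      rw [← Finset.add_sum_erase _ _ (Finset.mem_univ i),
        ← Finset.add_sum_erase _ (fun i => outer (Φ j i) (Φ j i)) (Finset.mem_univ i),
        Finset.sum_congr rfl (g := fun i => outer (Φ j i) (Φ j i)) fun i' hi' => by
          rw [Function.update_of_ne (Finset.ne_of_mem_erase hi')]]
      simp only [Function.update_self]
      abel
    rw [hup]
    congr 1
    simp only [g, E, outer_add_left, outer_add_right, outer_smul_left, outer_smul_right,
      Complex.star_def, Complex.conj_ofReal, smul_smul, smul_add, smul_sub, ← Complex.ofReal_mul]
    rw [show w s * w s = 1 - s ^ 2 by rw [← hs, sq]]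
    push_cast
    module

theorem inner_eq_zero_of_eigenvalue_ne {d : ℕ} {A : Matrix (Fin d) (Fin d) ℂ}
    (hA : A.IsHermitian) {u v : EuclideanSpace ℂ (Fin d)} {p q : ℝ} (hpq : p ≠ q)
    (hu : A.toEuclideanLin u = (p : ℂ) • u) (hv : A.toEuclideanLin v = (q : ℂ) • v) :
    ⟪u, v⟫_ℂ = 0 := by
  have h1 := isSymmetric_of_isHermitian hA u v
  rw [hu, hv, inner_smul_left, inner_smul_right, Complex.conj_ofReal, ← sub_eq_zero,
    ← sub_mul, mul_eq_zero, sub_eq_zero] at h1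
  exact h1.resolve_left fun h => hpq (by exact_mod_cast h)

/-- At a local minimizer, the `j`-th components of the vectors whose eigenvalue exceeds some
eigenvalue of the `j`-th completed frame operator are linearly independent. -/
theorem linearIndependent_of_isLocalMinOn (hα : ∀ i, 0 < α i) (hΦ : Φ ∈ designs α d)
    (hmin : IsLocalMinOn (jointPotential Φ₀) (designs α d) Φ) {c : Fin n → ℝ}
    (hc : ∀ i j, (totalOp Φ₀ Φ j).toEuclideanLin (Φ j i) = (c i : ℂ) • Φ j i) {j : Fin m}
    {h : EuclideanSpace ℂ (Fin (d j))} (hh : ‖h‖ = 1) {ν : ℝ}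
    (hν : (totalOp Φ₀ Φ j).toEuclideanLin h = (ν : ℂ) • h) :
    LinearIndependent ℂ fun i : {i // ν < c i} => Φ j i := by
  classical
  by_contra hdep
  obtain ⟨g, hg0, ⟨i₀, hi₀⟩, hgi₀⟩ := Fintype.not_linearIndependent_iff.mp hdep
  -- The dependence coefficients, extended by zero.
  set z : Fin n → ℂ := fun i => if hi : ν < c i then g ⟨i, hi⟩ else 0 with hz
  have hz0 : ∀ i, ¬ ν < c i → z i = 0 := fun i hi => by simp [hz, hi]
  have hzi₀ : z i₀ ≠ 0 := by simpa [hz, hi₀] using hgi₀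
  have hzsum : ∑ i, z i • Φ j i = 0 := by
    rw [← hg0]
    refine (Fintype.sum_of_injective Subtype.val Subtype.val_injective _ _ ?_ ?_).symm
    · intro i hi
      rw [hz0 i (by simpa using hi), zero_smul]
    · intro i
      simp [hz, i.2]
  -- The push is along `h` in block `j` only. The compensating rescaling `r i` acts on the `i`-th
  -- vectors of all blocks, since only their total weight is constrained.
  set H : (j : Fin m) → EuclideanSpace ℂ (Fin (d j)) := Pi.single j h with hH
  have hHne : ∀ j', j' ≠ j → H j' = 0 := fun j' hj' => by simp [hH, hj']
  have hHj : H j = h := by simp [hH]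
  have hTH : ∀ j', (totalOp Φ₀ Φ j').toEuclideanLin (H j') = (ν : ℂ) • H j' := by
    intro j'
    by_cases hj' : j' = j
    · subst hj'; rw [hHj, hν]
    · simp [hHne j' hj']
  have hHnorm : ∑ j', ‖H j'‖ ^ 2 = 1 := by
    rw [Finset.sum_eq_single j (fun j' _ hj' => by simp [hHne j' hj']) (by simp), hHj, hh, one_pow]
  have horth : ∀ i j', z i * ⟪H j', Φ j' i⟫_ℂ = 0 := by
    intro i j'
    by_cases hi : ν < c i
    · rw [inner_eq_zero_of_eigenvalue_ne (totalOp_isHermitian Φ₀ Φ j') hi.ne (hTH j') (hc i j'),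
        mul_zero]
    · rw [hz0 i hi, zero_mul]
  set Z := ∑ i, ‖z i‖ ^ 2 with hZ
  -- Since `h` is orthogonal to every vector moved, the push adds `s ^ 2 * ‖z i‖ ^ 2` to the `i`-th
  -- weight; the factor `r i` removes exactly this amount.
  set q : Fin n → ℝ := fun i => ‖z i‖ ^ 2 / α i with hq
  have hqα : ∀ i, q i * α i = ‖z i‖ ^ 2 := fun i => div_mul_cancel₀ _ (hα i).ne'
  set r : Fin n → ℝ → ℝ := fun i s => √(1 - s ^ 2 * q i) with hr
  have hrc : ∀ i, Continuous (r i) := fun i => by fun_prop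
  have hr2 : ∀ᶠ s in 𝓝 (0 : ℝ), ∀ i, r i s ^ 2 = 1 - s ^ 2 * q i :=
    eventually_all.mpr fun i =>
      (eventually_sq_le_one (q i)).mono fun s hs => Real.sq_sqrt (by linarith)
  let u : ℝ → (j : Fin m) → EuclideanSpace ℂ (Fin (d j)) := fun s j' =>
    ∑ i, ((r i s : ℂ) * z i) • Φ j' i
  have huc : ∀ j', Continuous fun s => u s j' := fun j' => by fun_prop
  have huH : ∀ s j', ⟪H j', u s j'⟫_ℂ = 0 := by
    intro s j'
    simp only [u, inner_sum, inner_smul_right, mul_assoc, horth, mul_zero, Finset.sum_const_zero]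
  let G : ℝ → Design d n := fun s j' i =>
    ((r i s : ℝ) : ℂ) • Φ j' i + ((s : ℂ) * star (z i)) • H j'
  let E : ℝ → (j : Fin m) → Matrix (Fin (d j)) (Fin (d j)) ℂ := fun s j' =>
    (∑ i, ((-(s * q i) : ℝ) : ℂ) • outer (Φ j' i) (Φ j' i)) +
      (outer (u s j') (H j') + outer (H j') (u s j') +
        ((s * Z : ℝ) : ℂ) • outer (H j') (H j'))
  have key := second_variation (E := E) (G := G) (τ := ∑ i, ‖z i‖ ^ 2 * (ν - c i))
    hmin ?_ ?_ ?_ ?_ ?_ ?_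
  -- The cross terms at `s = 0` involve `∑ i, z i • Φ j i`, which vanishes by dependence. Only `τ`,
  -- a sum of the negative quantities `‖z i‖ ^ 2 * (ν - c i)`, survives.
  · have hE0 : ∀ j', E 0 j' = 0 := by
      intro j'
      have hu0 : u 0 j' = ∑ i, z i • Φ j' i := by simp [u, hr]
      by_cases hj' : j' = j
      · subst hj'
        simp [E, hu0, hzsum]
      · simp [E, hHne j' hj']
    simp only [hE0, mul_zero, Matrix.trace_zero, Complex.zero_re, Finset.sum_const_zero,
      add_zero] at key
    have hneg : ∑ i, ‖z i‖ ^ 2 * (ν - c i) < 0 := by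
      refine Finset.sum_neg' (fun i _ => ?_) ⟨i₀, Finset.mem_univ _, ?_⟩
      · by_cases hi : ν < c i
        · exact mul_nonpos_of_nonneg_of_nonpos (by positivity) (by linarith)
        · simp [hz0 i hi]
      · exact mul_neg_of_pos_of_neg (by positivity) (by linarith)
    linarith
  · funext j' i
    simp [G, hr]
  · refine continuous_pi fun j' => continuous_pi fun i => ?_
    fun_prop
  · filter_upwards [hr2] with s hs i
    have h1 : ∀ j', ‖G s j' i‖ ^ 2 = r i s ^ 2 * ‖Φ j' i‖ ^ 2 + s ^ 2 * ‖z i‖ ^ 2 * ‖H j'‖ ^ 2 := by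
      intro j'
      have h2 : star (z i) * ⟪Φ j' i, H j'⟫_ℂ = 0 := by
        have := congrArg (starRingEnd ℂ) (horth i j')
        rwa [map_mul, map_zero, inner_conj_symm] at this
      have h3 : ⟪((r i s : ℝ) : ℂ) • Φ j' i, ((s : ℂ) * star (z i)) • H j'⟫_ℂ = 0 := by
        rw [inner_smul_left, inner_smul_right, mul_assoc (s : ℂ), h2, mul_zero, mul_zero]
      simp only [G, norm_add_sq_eq, h3, norm_smul, norm_mul, norm_star,
        Complex.norm_real, Real.norm_eq_abs, mul_pow, sq_abs]
      simp
    simp only [h1, Finset.sum_add_distrib, ← Finset.mul_sum, hHnorm]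
    rw [hΦ i, hs, ← hqα]
    ring
  · refine continuous_pi fun j' => ?_
    fun_prop
  · filter_upwards [hr2] with s hs j'
    have h1 : ∑ i, star ((s : ℂ) * star (z i)) • (((r i s : ℝ) : ℂ) • Φ j' i) =
        (s : ℂ) • u s j' := by
      simp only [u, Finset.smul_sum, smul_smul]
      refine Finset.sum_congr rfl fun i _ => ?_
      rw [star_mul', star_star, Complex.star_def, Complex.conj_ofReal]
      congr 1
      ring
    have h2 : ∑ i, ‖(s : ℂ) * star (z i)‖ ^ 2 = s ^ 2 * Z := by
      simp [hZ, mul_pow, Finset.mul_sum]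
    have h3 : frameOp (fun i => ((r i s : ℝ) : ℂ) • Φ j' i) = frameOp (Φ j') +
        (s : ℂ) • ∑ i, ((-(s * q i) : ℝ) : ℂ) • outer (Φ j' i) (Φ j' i) := by
      rw [frameOp, frameOp, Finset.smul_sum, ← Finset.sum_add_distrib]
      refine Finset.sum_congr rfl fun i _ => ?_
      rw [outer_smul_left, outer_smul_right, Complex.star_def, Complex.conj_ofReal, smul_smul,
        ← Complex.ofReal_mul, ← sq, hs]
      push_cast
      module
    have h4 : frameOp (G s j') = _ := frameOp_add_smul (fun i => ((r i s : ℝ) : ℂ) • Φ j' i)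
      (fun i => (s : ℂ) * star (z i)) (H j')
    rw [h4, h1, h2, h3]
    simp only [E, outer_smul_left, outer_smul_right, Complex.star_def, Complex.conj_ofReal]
    push_cast
    module
  · intro s
    have h1 : ∀ j', (totalOp Φ₀ Φ j' * E s j').trace.re =
        (∑ i, -(s * q i) * c i * ‖Φ j' i‖ ^ 2) + s * Z * ν * ‖H j'‖ ^ 2 := by
      intro j'
      have h2 : ⟪H j', (totalOp Φ₀ Φ j').toEuclideanLin (u s j')⟫_ℂ = 0 := by
        rw [← isSymmetric_of_isHermitian (totalOp_isHermitian Φ₀ Φ j'), hTH, inner_smul_left, huH,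
          mul_zero]
      have h3 : ⟪u s j', H j'⟫_ℂ = 0 := by rw [← inner_conj_symm, huH, map_zero]
      simp only [E, mul_add, Matrix.mul_sum, mul_smul_comm, Matrix.trace_add, Matrix.trace_sum,
        Matrix.trace_smul, trace_mul_outer, h2, hTH, hc, inner_smul_right, h3,
        inner_self_eq_norm_sq_to_K, Complex.add_re, Complex.re_sum, smul_eq_mul, mul_zero,
        zero_add]
      congr 1
      · refine Finset.sum_congr rfl fun i _ => ?_
        rw [mul_assoc (-(s * q i)), Complex.re_ofReal_mul, Complex.re_ofReal_mul]
        congr 2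
        exact_mod_cast Complex.ofReal_re _
      · rw [mul_assoc (s * Z), Complex.re_ofReal_mul, Complex.re_ofReal_mul]
        congr 2
        exact_mod_cast Complex.ofReal_re _
    simp only [h1, Finset.sum_add_distrib, ← Finset.mul_sum, hHnorm]
    rw [Finset.sum_comm]
    simp only [← Finset.mul_sum, hΦ _]
    rw [hZ, Finset.mul_sum, Finset.sum_mul, Finset.sum_mul, Finset.mul_sum,
      ← Finset.sum_add_distrib]
    refine Finset.sum_congr rfl fun i _ => ?_
    rw [← hqα]
    ring

/-- The `x`-component of `f` is replaced by the same multiple of the unit vector `w x + s y`. As `f`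
has no `y`-component, the norm is unchanged. -/
theorem norm_add_smul_rotation {d : ℕ} {f x y : EuclideanSpace ℂ (Fin d)} (hx : ‖x‖ = 1)
    (hy : ‖y‖ = 1) (hxy : ⟪x, y⟫_ℂ = 0) (hfy : ⟪f, y⟫_ℂ = 0) {w s : ℝ} (hw : w ^ 2 = 1 - s ^ 2) :
    ‖f + ⟪x, f⟫_ℂ • (((w - 1 : ℝ) : ℂ) • x + (s : ℂ) • y)‖ ^ 2 = ‖f‖ ^ 2 := by
  have h1 : ‖((w - 1 : ℝ) : ℂ) • x + (s : ℂ) • y‖ ^ 2 = 2 - 2 * w := by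
    rw [norm_add_sq_eq, inner_smul_left, inner_smul_right, hxy]
    simp only [norm_smul, Complex.norm_real, Real.norm_eq_abs, mul_pow, sq_abs, hx, hy]
    simp
    linarith
  have h2 : (⟪f, ⟪x, f⟫_ℂ • (((w - 1 : ℝ) : ℂ) • x + (s : ℂ) • y)⟫_ℂ).re =
      ‖⟪x, f⟫_ℂ‖ ^ 2 * (w - 1) := by
    rw [inner_smul_right, inner_add_right, inner_smul_right, inner_smul_right, hfy, mul_zero,
      add_zero, ← inner_conj_symm f x, mul_left_comm, Complex.mul_conj', ← Complex.ofReal_pow,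
      ← Complex.ofReal_mul, Complex.ofReal_re]
    ring
  rw [norm_add_sq_eq, h2, norm_smul, mul_pow, h1]
  ring

/-- Supplies the two coefficients of `frameOp_add_smul` for a rotation of the vectors in `I`; the
second is the inner product of the first with `x`. -/
theorem sum_masked_coeff {d n : ℕ} (F : Fin n → EuclideanSpace ℂ (Fin d))
    {x : EuclideanSpace ℂ (Fin d)} (hx : ‖x‖ = 1) (I : Finset (Fin n)) {a : ℝ}
    (ha : ∑ i ∈ I, ⟪F i, x⟫_ℂ • F i = (a : ℂ) • x) :
    ∑ i, star (if i ∈ I then ⟪x, F i⟫_ℂ else 0) • F i = (a : ℂ) • x ∧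
      ((∑ i, ‖if i ∈ I then ⟪x, F i⟫_ℂ else 0‖ ^ 2 : ℝ) : ℂ) = a := by
  have h0 : ∑ i, star (if i ∈ I then ⟪x, F i⟫_ℂ else 0) • F i = (a : ℂ) • x := by
    rw [← ha, ← Finset.sum_ite_mem_eq I]
    refine Finset.sum_congr rfl fun i _ => ?_
    by_cases hi : i ∈ I <;> simp [hi]
  refine ⟨h0, ?_⟩
  have h1 : ⟪x, ∑ i, star (if i ∈ I then ⟪x, F i⟫_ℂ else 0) • F i⟫_ℂ = a := by
    rw [h0, inner_smul_right, inner_self_eq_norm_sq_to_K, hx]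
    simp
  rw [← h1, inner_sum]
  push_cast
  refine Finset.sum_congr rfl fun i _ => ?_
  by_cases hi : i ∈ I
  · simp only [hi, if_true, inner_smul_right, Complex.star_def, Complex.conj_mul']
  · simp [hi]

/-- Rotating, inside a block, the vectors of two eigenvalues of the completed frame operator towards
each other does not decrease the potential at a local minimizer. -/
theorem rotation_inequality (hΦ : Φ ∈ designs α d)
    (hmin : IsLocalMinOn (jointPotential Φ₀) (designs α d) Φ) {c : Fin n → ℝ}
    (hc : ∀ i j, (totalOp Φ₀ Φ j).toEuclideanLin (Φ j i) = (c i : ℂ) • Φ j i) {j : Fin m}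
    {x y : EuclideanSpace ℂ (Fin (d j))} (hx : ‖x‖ = 1) (hy : ‖y‖ = 1) {γ γ' a b : ℝ}
    (hγ : γ ≠ γ') (hTx : (totalOp Φ₀ Φ j).toEuclideanLin x = (γ : ℂ) • x)
    (hTy : (totalOp Φ₀ Φ j).toEuclideanLin y = (γ' : ℂ) • y) {I I' : Finset (Fin n)}
    (hI : ∀ i ∈ I, c i = γ) (hI' : ∀ i ∈ I', c i = γ')
    (ha : ∑ i ∈ I, ⟪Φ j i, x⟫_ℂ • Φ j i = (a : ℂ) • x)
    (hb : ∑ i ∈ I', ⟪Φ j i, y⟫_ℂ • Φ j i = (b : ℂ) • y) (κ : ℝ) :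
    0 ≤ (γ - γ') * (b * κ ^ 2 - a) + (a - b * κ) ^ 2 := by
  classical
  have orth := @inner_eq_zero_of_eigenvalue_ne _ _ (totalOp_isHermitian Φ₀ Φ j)
  have hxy : ⟪x, y⟫_ℂ = 0 := orth hγ hTx hTy
  have hyx : ⟪y, x⟫_ℂ = 0 := orth hγ.symm hTy hTx
  have hdisj : ∀ i ∈ I, i ∉ I' := fun i h1 h2 => hγ ((hI i h1).symm.trans (hI' i h2))
  set ξ : Fin n → ℂ := fun i => if i ∈ I then ⟪x, Φ j i⟫_ℂ else 0 with hξ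
  set η : Fin n → ℂ := fun i => if i ∈ I' then ⟪y, Φ j i⟫_ℂ else 0 with hη
  set w : ℝ → ℝ := fun s => √(1 - s ^ 2) with hw
  -- The vectors of `I` turn `x` towards `y` with sine `s`; those of `I'` turn `y` towards `x` with
  -- sine `-κ s`. The free ratio `κ` is optimized in `rotation_gap`.
  set w' : ℝ → ℝ := fun s => √(1 - s ^ 2 * κ ^ 2) with hw'
  have hwc : Continuous w := by fun_prop
  have hwc' : Continuous w' := by fun_prop
  have hw2 : ∀ᶠ s in 𝓝 (0 : ℝ), w s ^ 2 = 1 - s ^ 2 :=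
    (eventually_sq_le_one 1).mono fun s hs => Real.sq_sqrt (by linarith)
  have hw2' : ∀ᶠ s in 𝓝 (0 : ℝ), w' s ^ 2 = 1 - s ^ 2 * κ ^ 2 :=
    (eventually_sq_le_one (κ ^ 2)).mono fun s hs => Real.sq_sqrt (by linarith)
  let p : ℝ → EuclideanSpace ℂ (Fin (d j)) := fun s =>
    ((w s - 1 : ℝ) : ℂ) • x + (s : ℂ) • y
  let p' : ℝ → EuclideanSpace ℂ (Fin (d j)) := fun s =>
    ((w' s - 1 : ℝ) : ℂ) • y + ((-(κ * s) : ℝ) : ℂ) • x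
  have hpc : Continuous p := by fun_prop
  have hpc' : Continuous p' := by fun_prop
  let g : ℝ → Fin n → EuclideanSpace ℂ (Fin (d j)) := fun s i =>
    Φ j i + ξ i • p s + η i • p' s
  let G : ℝ → Design d n := fun s => Function.update Φ j (g s)
  let e : ℝ → Matrix (Fin (d j)) (Fin (d j)) ℂ := fun s =>
    ((a * w s - b * κ * w' s : ℝ) : ℂ) • (outer x y + outer y x) +
      ((s * (b * κ ^ 2 - a) : ℝ) : ℂ) • (outer x x - outer y y)
  let E : ℝ → (j : Fin m) → Matrix (Fin (d j)) (Fin (d j)) ℂ := fun s =>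
    Function.update (fun _ => 0) j (e s)
  have hxx : ⟪x, x⟫_ℂ = 1 := by simp [inner_self_eq_norm_sq_to_K, hx]
  have hyy : ⟪y, y⟫_ℂ = 1 := by simp [inner_self_eq_norm_sq_to_K, hy]
  obtain ⟨hsumξ, hsqξ⟩ : (∑ i, star (ξ i) • Φ j i = (a : ℂ) • x) ∧
    ((∑ i, ‖ξ i‖ ^ 2 : ℝ) : ℂ) = a := sum_masked_coeff (Φ j) hx I ha
  obtain ⟨hsumη, hsqη⟩ : (∑ i, star (η i) • Φ j i = (b : ℂ) • y) ∧
    ((∑ i, ‖η i‖ ^ 2 : ℝ) : ℂ) = b := sum_masked_coeff (Φ j) hy I' hb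
  have hξη : ∀ i, star (η i) * ξ i = 0 := by
    intro i
    by_cases hi : i ∈ I
    · simp [hη, hdisj i hi]
    · simp [hξ, hi]
  have key := second_variation (E := E) (G := G) (τ := (γ - γ') * (b * κ ^ 2 - a))
    hmin ?_ ?_ ?_ ?_ ?_ ?_
  · have hE0 : (e 0 * e 0).trace.re = 2 * (a - b * κ) ^ 2 := by
      have : e 0 = ((a - b * κ : ℝ) : ℂ) • (outer x y + outer y x) := by simp [e, hw, hw']
      rw [this, smul_mul_assoc, mul_smul_comm, mul_add, mul_outer, mul_outer]
      simp only [map_add, LinearMap.add_apply, toEuclideanLin_outer, hxx, hyy, hxy, hyx,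
        Matrix.trace_smul, Matrix.trace_add, trace_outer, zero_smul, one_smul, zero_add, add_zero,
        smul_eq_mul]
      rw [← mul_assoc, ← Complex.ofReal_mul, Complex.re_ofReal_mul]
      norm_num
      ring
    have hsum : ∑ j, (E 0 j * E 0 j).trace.re = (e 0 * e 0).trace.re := by
      rw [Finset.sum_eq_single j]
      · simp [E]
      · intro j' _ hj'
        simp [E, Function.update_of_ne hj']
      · simp
    rw [hsum, hE0] at key
    linarith
  · funext j'
    by_cases hj : j' = j
    · subst hj
      simp [G, g, p, p', hw, hw']
    · simp [G, hj]
  · refine Continuous.update continuous_const j ?_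
    fun_prop
  · filter_upwards [hw2, hw2'] with s hs hs' i
    rw [← hΦ i]
    refine Finset.sum_congr rfl fun j' _ => ?_
    by_cases hj : j' = j
    · subst hj
      simp only [G, Function.update_self, g]
      by_cases hi : i ∈ I
      · have : η i = 0 := by simp [hη, hdisj i hi]
        rw [this, zero_smul, add_zero]
        simp only [hξ, hi, if_true]
        exact norm_add_smul_rotation hx hy hxy (orth hγ (hI i hi ▸ hc i j') hTy) hs
      · have : ξ i = 0 := by simp [hξ, hi]
        rw [this, zero_smul, add_zero]
        by_cases hi' : i ∈ I'
        · simp only [hη, hi', if_true]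
          exact norm_add_smul_rotation hy hx hyx (orth hγ.symm (hI' i hi' ▸ hc i j') hTx)
            (by rw [hs']; ring)
        · simp [hη, hi']
    · simp [G, hj]
  · refine Continuous.update continuous_const j ?_
    fun_prop
  · filter_upwards [hw2, hw2'] with s hs hs' j'
    by_cases hj : j' = j
    · subst hj
      simp only [G, E, Function.update_self]
      have h1 : frameOp (g s) = _ := frameOp_add_smul (fun i => Φ j' i + ξ i • p s) η (p' s)
      have h2 : ∑ i, star (η i) • (Φ j' i + ξ i • p s) = (b : ℂ) • y := by
        simp only [smul_add, smul_smul, hξη, zero_smul, add_zero, hsumη]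
      rw [h1, h2, hsqη, frameOp_add_smul, hsumξ, hsqξ]
      simp only [add_assoc]
      congr 1
      simp only [p, p', e, outer_add_left, outer_add_right, outer_smul_left, outer_smul_right,
        Complex.star_def, Complex.conj_ofReal, smul_add, smul_sub, smul_smul,
        ← Complex.ofReal_mul]
      have hsC : (w s : ℂ) ^ 2 = 1 - (s : ℂ) ^ 2 := by exact_mod_cast hs
      have hsC' : (w' s : ℂ) ^ 2 = 1 - (s : ℂ) ^ 2 * (κ : ℂ) ^ 2 := by exact_mod_cast hs'
      push_cast
      linear_combination (norm := module) ((a : ℂ) * hsC) • outer x x +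
        ((b : ℂ) * hsC') • outer y y
    · simp [G, E, hj]
  · intro s
    rw [Finset.sum_eq_single j]
    · simp only [E, Function.update_self, e, mul_add, mul_sub, mul_smul_comm, Matrix.trace_add,
        Matrix.trace_sub, Matrix.trace_smul, trace_mul_outer, hTx, hTy, inner_smul_right, hxx, hyy,
        hxy, hyx]
      simp [-Complex.ofReal_pow]
      ring
    · intro j' _ hj'
      simp [E, Function.update_of_ne hj']
    · simp

end Variation

/-! ### Majorization and trace inequalities. -/

section Majorization

/-- Abel summation: a non-negative non-increasing weight is a non-negative combination of indicators
of initial segments. The induction peels off the constant `μ (Fin.last d)`. -/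
theorem sum_mul_nonneg_of_antitone {d : ℕ} {μ x : Fin d → ℝ} (hμ : Antitone μ) (hμ0 : ∀ i, 0 ≤ μ i)
    (hx : ∀ k, 0 ≤ ∑ l ∈ Finset.Iic k, x l) : 0 ≤ ∑ l, μ l * x l := by
  induction d with
  | zero => simp
  | succ d ih =>
    have h1 := ih (μ := fun i => μ i.castSucc - μ (Fin.last d)) (x := fun i => x i.castSucc)
      (fun a b h => by simpa using hμ (Fin.castSucc_le_castSucc_iff.mpr h))
      (fun i => sub_nonneg.mpr (hμ (Fin.le_last _)))
      (fun k => by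
        have := hx k.castSucc
        rwa [← Fin.map_castSuccEmb_Iic, Finset.sum_map] at this)
    have h2 := hx (Fin.last d)
    have h3 : (Finset.Iic (Fin.last d)) = Finset.univ := by ext; simp [Fin.le_last]
    rw [h3, Fin.sum_univ_castSucc] at h2
    rw [Fin.sum_univ_castSucc]
    simp only [sub_mul, Finset.sum_sub_distrib, ← Finset.mul_sum] at h1
    nlinarith [mul_nonneg (hμ0 (Fin.last d)) h2]

/-- The rearrangement inequality for a substochastic matrix. -/
theorem sum_substochastic_le {d n : ℕ} (hdn : d ≤ n) {μ : Fin d → ℝ} {c : Fin n → ℝ}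
    (hμ : Antitone μ) (hμ0 : ∀ l, 0 ≤ μ l) (hc : Antitone c) (hc0 : ∀ i, 0 ≤ c i)
    {p : Fin d → Fin n → ℝ} (hp : ∀ l i, 0 ≤ p l i) (hrow : ∀ l, ∑ i, p l i ≤ 1)
    (hcol : ∀ i, ∑ l, p l i ≤ 1) :
    ∑ l, μ l * ∑ i, p l i * c i ≤ ∑ l, μ l * c (Fin.castLE hdn l) := by
  rw [← sub_nonneg, ← Finset.sum_sub_distrib]
  simp only [← mul_sub]
  refine sum_mul_nonneg_of_antitone hμ hμ0 fun k => ?_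
  rw [Finset.sum_sub_distrib, sub_nonneg, Finset.sum_comm]
  simp only [← Finset.sum_mul]
  set w : Fin n → ℝ := fun i => ∑ l ∈ Finset.Iic k, p l i with hw
  set ck := c (Fin.castLE hdn k) with hck
  have hw0 : ∀ i, 0 ≤ w i := fun i => Finset.sum_nonneg fun l _ => hp l i
  have hw1 : ∀ i, w i ≤ 1 := fun i =>
    (Finset.sum_le_univ_sum_of_nonneg fun l => hp l i).trans (hcol i)
  have hwsum : ∑ i, w i ≤ (Finset.Iic k).card := by
    rw [hw, Finset.sum_comm]
    exact (Finset.sum_le_sum fun l _ => hrow l).trans (by simp)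
  set ind : Fin n → ℝ := fun i => if i ≤ Fin.castLE hdn k then 1 else 0 with hind
  have hmap : (Finset.Iic k).map (Fin.castLEEmb hdn) =
      Finset.univ.filter fun i => i ≤ Fin.castLE hdn k := by
    ext i
    simp only [Finset.mem_map, Finset.mem_Iic, Finset.mem_filter, Finset.mem_univ, true_and]
    constructor
    · rintro ⟨l, hl, rfl⟩
      exact hl
    · intro hi
      exact ⟨⟨i, lt_of_le_of_lt hi k.2⟩, hi, rfl⟩
  have hindc : ∑ l ∈ Finset.Iic k, c (Fin.castLE hdn l) = ∑ i, ind i * c i := by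
    simp only [hind, ite_mul, one_mul, zero_mul]
    rw [← Finset.sum_filter, ← hmap, Finset.sum_map]
    rfl
  have hindsum : ∑ i, ind i = (Finset.Iic k).card := by
    rw [hind, ← Finset.sum_filter, ← hmap]
    simp
  rw [hindc]
  -- Bathtub argument: among weights in `[0, 1]` of total at most `k + 1`, the indicator of the
  -- first `k + 1` indices collects the most of `c`. Centring at `ck` makes each term have a sign.
  have hterm : ∀ i, (w i - ind i) * (c i - ck) ≤ 0 := by
    intro i
    by_cases hi : i ≤ Fin.castLE hdn k
    · simp only [hind, hi, if_true]
      exact mul_nonpos_of_nonpos_of_nonneg (by linarith [hw1 i]) (sub_nonneg.mpr (hc hi))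
    · simp only [hind, hi, if_false, sub_zero]
      exact mul_nonpos_of_nonneg_of_nonpos (hw0 i) (sub_nonpos.mpr (hc (not_le.mp hi).le))
  have hsum := Finset.sum_nonpos fun i (_ : i ∈ Finset.univ) => hterm i
  have hexp : ∑ i, (w i - ind i) * (c i - ck) =
      ∑ i, w i * c i - ∑ i, ind i * c i - ck * (∑ i, w i - ∑ i, ind i) := by
    rw [← Finset.sum_sub_distrib, ← Finset.sum_sub_distrib, Finset.mul_sum,
      ← Finset.sum_sub_distrib]
    exact Finset.sum_congr rfl fun i _ => by ring
  have hck0 : 0 ≤ ck := hc0 _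
  nlinarith [mul_nonneg hck0 (sub_nonneg.mpr hwsum)]

theorem sum_sq_inner_basis {d : ℕ} (v : OrthonormalBasis (Fin d) ℂ (EuclideanSpace ℂ (Fin d)))
    (x : EuclideanSpace ℂ (Fin d)) : ∑ i, ‖⟪v i, x⟫_ℂ‖ ^ 2 = ‖x‖ ^ 2 :=
  v.sum_sq_norm_inner_right x

theorem frameOp_eigenvalue_eq {d k : ℕ} {F : Fin k → EuclideanSpace ℂ (Fin d)}
    {x : EuclideanSpace ℂ (Fin d)} (hx : ‖x‖ = 1) {a : ℝ}
    (h : (frameOp F).toEuclideanLin x = (a : ℂ) • x) : a = ∑ i, ‖⟪F i, x⟫_ℂ‖ ^ 2 := by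
  have h1 : (a : ℂ) = ((∑ i, ‖⟪F i, x⟫_ℂ‖ ^ 2 : ℝ) : ℂ) := by
    rw [← inner_frameOp, h, inner_smul_right, inner_self_eq_norm_sq_to_K, hx]
    simp
  exact_mod_cast h1

/-- The squared norms of the vectors of a sequence are majorized by the eigenvalues of its frame
operator. -/
theorem sum_mul_norm_sq_le {d n : ℕ} (hdn : d ≤ n) (F : Fin n → EuclideanSpace ℂ (Fin d))
    {c : Fin n → ℝ} (hc : Antitone c) (hc0 : ∀ i, 0 ≤ c i) :
    ∑ i, c i * ‖F i‖ ^ 2 ≤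
      ∑ l, eigDown (frameOp_isHermitian F) l * c (Fin.castLE hdn l) := by
  obtain ⟨u, hu⟩ := exists_eigDown_basis (frameOp_isHermitian F)
  set μ := eigDown (frameOp_isHermitian F) with hμ
  have hrow : ∀ l, ∑ i, ‖⟪u l, F i⟫_ℂ‖ ^ 2 = μ l := by
    intro l
    simp only [frameOp_eigenvalue_eq (u.norm_eq_one l) (hu l), norm_inner_symm (F _)]
  have hμ0 : ∀ l, 0 ≤ μ l := fun l => hrow l ▸ Finset.sum_nonneg fun i _ => by positivity
  -- If `μ l = 0`, its row sum vanishes, so each entry does; the convention `a / 0 = 0` then keeps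
  -- the identity true and the row substochastic.
  have hentry : ∀ l i, ‖⟪u l, F i⟫_ℂ‖ ^ 2 = μ l * (‖⟪u l, F i⟫_ℂ‖ ^ 2 / μ l) := by
    intro l i
    by_cases h : μ l = 0
    · have := (Finset.sum_eq_zero_iff_of_nonneg fun i _ => by positivity).mp ((hrow l).trans h) i
        (Finset.mem_univ i)
      rw [this, h, zero_mul]
    · field_simp
  have hcol : ∀ i, ∑ l, ‖⟪u l, F i⟫_ℂ‖ ^ 2 / μ l ≤ 1 := by
    intro i
    set s := ∑ l, ‖⟪u l, F i⟫_ℂ‖ ^ 2 / μ l with hs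
    -- The pseudo-inverse of the frame operator applied to `F i`. It gives `⟪x, S x⟫ = ⟪x, F i⟫ =
    -- s`; keeping only the `i`-th term of `∑ k, ‖⟪F k, x⟫‖ ^ 2 = s` gives `s ^ 2 ≤ s`.
    set x := ∑ l, (⟪u l, F i⟫_ℂ / μ l) • u l with hx
    have h1 : ⟪x, F i⟫_ℂ = s := by
      rw [hx, hs, sum_inner]
      push_cast
      refine Finset.sum_congr rfl fun l _ => ?_
      rw [inner_smul_left, map_div₀, Complex.conj_ofReal, div_mul_eq_mul_div, Complex.conj_mul']
    have h2 : ⟪x, (frameOp F).toEuclideanLin x⟫_ℂ = s := by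
      conv_lhs => enter [2]; rw [hx]
      rw [map_sum, inner_sum, hs]
      push_cast
      refine Finset.sum_congr rfl fun l _ => ?_
      have h3 : ⟪x, u l⟫_ℂ = star (⟪u l, F i⟫_ℂ / μ l) := by
        rw [hx, sum_inner, Finset.sum_eq_single l]
        · rw [inner_smul_left, inner_self_eq_norm_sq_to_K, u.norm_eq_one]
          simp
        · intro l' _ hl'
          rw [inner_smul_left, u.inner_eq_ite, if_neg hl', mul_zero]
        · simp
      rw [map_smul, hu, smul_smul, inner_smul_right, h3, mul_right_comm, Complex.star_def,
        Complex.mul_conj', norm_div, Complex.norm_real, Real.norm_of_nonneg (hμ0 l)]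
      by_cases h : μ l = 0
      · simp [h]
      · have : (μ l : ℂ) ≠ 0 := by exact_mod_cast h
        push_cast
        field_simp
    have h4 : s ^ 2 ≤ s := by
      have h5 : ∑ k, ‖⟪F k, x⟫_ℂ‖ ^ 2 = s := by
        have := inner_frameOp F x
        rw [h2] at this
        exact_mod_cast this.symm
      have h6 := Finset.single_le_sum (f := fun k => ‖⟪F k, x⟫_ℂ‖ ^ 2)
        (fun k _ => by positivity) (Finset.mem_univ i)
      rw [h5] at h6
      rwa [norm_inner_symm, h1, Complex.norm_real, Real.norm_eq_abs, sq_abs] at h6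
    nlinarith
  have key := sum_substochastic_le hdn (eigDown_antitone (frameOp_isHermitian F)) hμ0 hc hc0
    (p := fun l i => ‖⟪u l, F i⟫_ℂ‖ ^ 2 / μ l) (fun l i => div_nonneg (by positivity) (hμ0 l))
    (fun l => by
      rw [← Finset.sum_div, hrow]
      exact div_self_le_one _)
    hcol
  refine le_trans (le_of_eq ?_) key
  calc ∑ i, c i * ‖F i‖ ^ 2 = ∑ i, ∑ l, c i * ‖⟪u l, F i⟫_ℂ‖ ^ 2 := by
        refine Finset.sum_congr rfl fun i _ => ?_
        rw [← Finset.mul_sum, sum_sq_inner_basis]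
    _ = ∑ l, ∑ i, c i * ‖⟪u l, F i⟫_ℂ‖ ^ 2 := Finset.sum_comm
    _ = _ := by
        refine Finset.sum_congr rfl fun l _ => ?_
        rw [Finset.mul_sum]
        refine Finset.sum_congr rfl fun i _ => ?_
        linear_combination c i * hentry l i

/-- The trace of the product of two Hermitian matrices is at least the product of the oppositely
ordered spectra. -/
theorem sum_eigUp_mul_eigDown_le_trace {d : ℕ} {A B : Matrix (Fin d) (Fin d) ℂ}
    (hA : A.IsHermitian) (hB : B.IsHermitian) (hB0 : ∀ i, 0 ≤ eigDown hB i) :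
    ∑ i, eigUp hA i * eigDown hB i ≤ (A * B).trace.re := by
  obtain ⟨u, hu⟩ := exists_eigDown_basis hB
  obtain ⟨v', hv'⟩ := exists_eigDown_basis hA
  set v := v'.reindex Fin.revPerm with hv
  have hva : ∀ i, A.toEuclideanLin (v i) = (eigUp hA i : ℂ) • v i := by
    intro i
    simp only [hv, OrthonormalBasis.reindex_apply]
    exact hv' i.rev
  have hmono : Monotone (eigUp hA) := fun a b h => eigDown_antitone hA (Fin.rev_le_rev.mpr h)
  -- The shift by `C` turns the non-decreasing `eigUp` into a non-negative non-increasing weight. It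
  -- costs nothing because the overlap matrix is doubly stochastic.
  obtain ⟨C, hC⟩ : ∃ C, ∀ i, eigUp hA i ≤ C := (Set.finite_range (eigUp hA)).bddAbove.imp
    fun C h i => h ⟨i, rfl⟩
  have hrow : ∀ l, ∑ i, ‖⟪v i, u l⟫_ℂ‖ ^ 2 = 1 := fun l => by
    rw [sum_sq_inner_basis, u.norm_eq_one, one_pow]
  have hcol : ∀ i, ∑ l, ‖⟪v i, u l⟫_ℂ‖ ^ 2 = 1 := fun i => by
    simp only [norm_inner_symm (v i)]
    rw [sum_sq_inner_basis, v.norm_eq_one, one_pow]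
  have key := sum_substochastic_le le_rfl (eigDown_antitone hB) hB0
    (c := fun i => C - eigUp hA i) (fun a b h => sub_le_sub_left (hmono h) C)
    (fun i => sub_nonneg.mpr (hC i)) (p := fun l i => ‖⟪v i, u l⟫_ℂ‖ ^ 2)
    (fun l i => by positivity) (fun l => (hrow l).le) (fun i => (hcol i).le)
  have htr : (A * B).trace.re =
      ∑ l, eigDown hB l * ∑ i, ‖⟪v i, u l⟫_ℂ‖ ^ 2 * eigUp hA i := by
    rw [trace_eq_sum_of_eigen u _ hu, Complex.re_sum]
    refine Finset.sum_congr rfl fun l _ => ?_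
    rw [Complex.re_ofReal_mul]
    congr 1
    conv_lhs => rw [eq_sum_outer_of_eigen v _ hva]
    rw [toEuclideanLin_sum, inner_sum, Complex.re_sum]
    refine Finset.sum_congr rfl fun i _ => ?_
    rw [map_smul, LinearMap.smul_apply, toEuclideanLin_outer, inner_smul_right, inner_smul_right,
      ← inner_conj_symm (u l) (v i), Complex.mul_conj', Complex.re_ofReal_mul,
      ← Complex.ofReal_pow, Complex.ofReal_re, mul_comm]
  rw [htr]
  simp only [mul_sub, Finset.sum_sub_distrib, ← Finset.sum_mul, hrow, Fin.castLE_rfl] at key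
  simp only [one_mul, id] at key
  simp only [mul_comm (eigUp hA _)]
  linarith

end Majorization

/-! ### Structure of local minimizers. -/

section Structure

variable {m k n : ℕ} {d : Fin m → ℕ} {α : Fin n → ℝ} {Φ₀ : Design d k} {Φ : Design d n}

theorem frameOp_eigenvalue_nonneg {d k : ℕ} {F : Fin k → EuclideanSpace ℂ (Fin d)}
    {x : EuclideanSpace ℂ (Fin d)} (hx : ‖x‖ = 1) {a : ℝ}
    (h : (frameOp F).toEuclideanLin x = (a : ℂ) • x) : 0 ≤ a := by
  rw [frameOp_eigenvalue_eq hx h]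
  positivity

theorem eigDown_frameOp_nonneg {d k : ℕ} (F : Fin k → EuclideanSpace ℂ (Fin d)) (i : Fin d) :
    0 ≤ eigDown (frameOp_isHermitian F) i := by
  obtain ⟨u, hu⟩ := exists_eigDown_basis (frameOp_isHermitian F)
  exact frameOp_eigenvalue_nonneg (u.norm_eq_one i) (hu i)

/-- The quantitative form of the rotation inequality. -/
theorem rotation_gap (hΦ : Φ ∈ designs α d)
    (hmin : IsLocalMinOn (jointPotential Φ₀) (designs α d) Φ) {c : Fin n → ℝ}
    (hc : ∀ i j, (totalOp Φ₀ Φ j).toEuclideanLin (Φ j i) = (c i : ℂ) • Φ j i) {j : Fin m}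
    {x y : EuclideanSpace ℂ (Fin (d j))} (hx : ‖x‖ = 1) (hy : ‖y‖ = 1) {γ γ' a b : ℝ}
    (hγ : γ' < γ) (ha0 : 0 < a) (hb0 : 0 ≤ b)
    (hTx : (totalOp Φ₀ Φ j).toEuclideanLin x = (γ : ℂ) • x)
    (hTy : (totalOp Φ₀ Φ j).toEuclideanLin y = (γ' : ℂ) • y) {I I' : Finset (Fin n)}
    (hI : ∀ i ∈ I, c i = γ) (hI' : ∀ i ∈ I', c i = γ')
    (ha : ∑ i ∈ I, ⟪Φ j i, x⟫_ℂ • Φ j i = (a : ℂ) • x)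
    (hb : ∑ i ∈ I', ⟪Φ j i, y⟫_ℂ • Φ j i = (b : ℂ) • y) : b + (γ - γ') ≤ a := by
  have hΔ : 0 < γ - γ' := sub_pos.mpr hγ
  have hs : 0 < γ - γ' + b := by linarith
  -- This ratio minimizes the quadratic in `κ`.
  have h := rotation_inequality hΦ hmin hc hx hy hγ.ne' hTx hTy hI hI' ha hb (a / (γ - γ' + b))
  have h2 : (γ - γ') * (b * (a / (γ - γ' + b)) ^ 2 - a) + (a - b * (a / (γ - γ' + b))) ^ 2 =
      (γ - γ') * a * (a - (b + (γ - γ'))) / (γ - γ' + b) := by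
    field_simp
    ring
  rw [h2] at h
  by_contra! hlt
  have : (γ - γ') * a * (a - (b + (γ - γ'))) / (γ - γ' + b) < 0 :=
    div_neg_of_neg_of_pos (mul_neg_of_pos_of_neg (mul_pos hΔ ha0) (by linarith)) hs
  linarith

/-- Eigenvectors of `totalOp` for different eigenvalues are orthogonal, so only the vectors with `c
i = γ` see `x`. The partial frame operators in `rotation_gap` thus become the full one. -/
theorem sum_filter_eigenvalue {c : Fin n → ℝ}
    (hc : ∀ i j, (totalOp Φ₀ Φ j).toEuclideanLin (Φ j i) = (c i : ℂ) • Φ j i) {j : Fin m}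
    {x : EuclideanSpace ℂ (Fin (d j))} {γ : ℝ}
    (hTx : (totalOp Φ₀ Φ j).toEuclideanLin x = (γ : ℂ) • x) :
    ∑ i with c i = γ, ⟪Φ j i, x⟫_ℂ • Φ j i = (frameOp (Φ j)).toEuclideanLin x := by
  rw [toEuclideanLin_frameOp, Finset.sum_filter]
  refine Finset.sum_congr rfl fun i _ => ?_
  by_cases hi : c i = γ
  · rw [if_pos hi]
  · rw [if_neg hi, inner_eq_zero_of_eigenvalue_ne (totalOp_isHermitian Φ₀ Φ j) hi (hc i j) hTx,
      zero_smul]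

/-- The rotation gap for joint eigenvectors. -/
theorem eigenvector_gap (hΦ : Φ ∈ designs α d)
    (hmin : IsLocalMinOn (jointPotential Φ₀) (designs α d) Φ) {c : Fin n → ℝ}
    (hc : ∀ i j, (totalOp Φ₀ Φ j).toEuclideanLin (Φ j i) = (c i : ℂ) • Φ j i) {j : Fin m}
    {x y : EuclideanSpace ℂ (Fin (d j))} (hx : ‖x‖ = 1) (hy : ‖y‖ = 1) {γ γ' a b : ℝ}
    (hγ : γ' < γ) (ha0 : 0 < a)
    (hTx : (totalOp Φ₀ Φ j).toEuclideanLin x = (γ : ℂ) • x)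
    (hTy : (totalOp Φ₀ Φ j).toEuclideanLin y = (γ' : ℂ) • y)
    (ha : (frameOp (Φ j)).toEuclideanLin x = (a : ℂ) • x)
    (hb : (frameOp (Φ j)).toEuclideanLin y = (b : ℂ) • y) : b + (γ - γ') ≤ a :=
  rotation_gap hΦ hmin hc hx hy hγ ha0 (frameOp_eigenvalue_nonneg hy hb) hTx hTy
    (I := {i | c i = γ}) (I' := {i | c i = γ'}) (by simp) (by simp)
    ((sum_filter_eigenvalue hc hTx).trans ha) ((sum_filter_eigenvalue hc hTy).trans hb)

/-- Were `c i < c i'` with `i ≤ i'`, then in each block where `Φ j i` is nonzero independence would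
make `Φ j i'` nonzero and the gap would make it strictly longer. Summing over blocks gives `α i < α
i'`. -/
theorem antitone_eigenvalue (hα : ∀ i, 0 < α i) (hα' : Antitone α) (hΦ : Φ ∈ designs α d)
    (hmin : IsLocalMinOn (jointPotential Φ₀) (designs α d) Φ) {c : Fin n → ℝ}
    (hc : ∀ i j, (totalOp Φ₀ Φ j).toEuclideanLin (Φ j i) = (c i : ℂ) • Φ j i) : Antitone c := by
  intro i i' hii'
  by_contra! hlt
  have normalize : ∀ (j : Fin m) (i : Fin n), Φ j i ≠ 0 →
      ‖((‖Φ j i‖⁻¹ : ℝ) : ℂ) • Φ j i‖ = 1 ∧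
      (totalOp Φ₀ Φ j).toEuclideanLin (((‖Φ j i‖⁻¹ : ℝ) : ℂ) • Φ j i) =
        (c i : ℂ) • (((‖Φ j i‖⁻¹ : ℝ) : ℂ) • Φ j i) ∧
      ∑ l ∈ {i}, ⟪Φ j l, ((‖Φ j i‖⁻¹ : ℝ) : ℂ) • Φ j i⟫_ℂ • Φ j l =
        ((‖Φ j i‖ ^ 2 : ℝ) : ℂ) • (((‖Φ j i‖⁻¹ : ℝ) : ℂ) • Φ j i) := by
    intro j i hi
    have hn : ‖Φ j i‖ ≠ 0 := norm_ne_zero_iff.mpr hi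
    refine ⟨?_, ?_, ?_⟩
    · rw [norm_smul, Complex.norm_real, norm_inv, norm_norm, inv_mul_cancel₀ hn]
    · rw [map_smul, hc, smul_comm]
    · rw [Finset.sum_singleton, inner_smul_right, inner_self_eq_norm_sq_to_K, smul_smul]
      congr 1
      push_cast
      exact mul_comm _ _
  have hstrict : ∀ j, Φ j i ≠ 0 → ‖Φ j i‖ ^ 2 < ‖Φ j i'‖ ^ 2 := by
    intro j hi
    obtain ⟨hy, hTy, hSy⟩ := normalize j i hi
    have hi' : Φ j i' ≠ 0 :=
      (linearIndependent_of_isLocalMinOn hα hΦ hmin hc hy hTy).ne_zero ⟨i', hlt⟩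
    obtain ⟨hx, hTx, hSx⟩ := normalize j i' hi'
    have := rotation_gap hΦ hmin hc hx hy hlt (by positivity) (by positivity) hTx hTy
      (I := {i'}) (I' := {i}) (by simp) (by simp) hSx hSy
    linarith
  have hle : ∀ j, ‖Φ j i‖ ^ 2 ≤ ‖Φ j i'‖ ^ 2 := by
    intro j
    by_cases hi : Φ j i = 0
    · simp only [hi, norm_zero, ne_eq, OfNat.ofNat_ne_zero, not_false_eq_true, zero_pow]
      positivity
    · exact (hstrict j hi).le
  obtain ⟨j, hj⟩ : ∃ j, Φ j i ≠ 0 := by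
    by_contra! h
    have := hΦ i
    simp only [h, norm_zero] at this
    have := hα i
    simp_all
  have hsum : ∑ j, ‖Φ j i‖ ^ 2 < ∑ j, ‖Φ j i'‖ ^ 2 :=
    Finset.sum_lt_sum (fun j _ => hle j) ⟨j, Finset.mem_univ j, hstrict j hj⟩
  rw [hΦ i, hΦ i'] at hsum
  exact absurd (hα' hii') (not_le.mpr hsum)

/-- The product `T_j S_{F_j}` equals `∑ i, c_i f_{i,j} ⊗ f_{i,j}` with real `c_i`, hence is
Hermitian, so the two factors commute. -/
theorem commute_frameOp {c : Fin n → ℝ}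
    (hc : ∀ i j, (totalOp Φ₀ Φ j).toEuclideanLin (Φ j i) = (c i : ℂ) • Φ j i) (j : Fin m) :
    Commute (frameOp (Φ₀ j)) (frameOp (Φ j)) := by
  have h1 : totalOp Φ₀ Φ j * frameOp (Φ j) = ∑ i, (c i : ℂ) • outer (Φ j i) (Φ j i) := by
    rw [frameOp, Matrix.mul_sum]
    refine Finset.sum_congr rfl fun i _ => ?_
    rw [mul_outer, hc, outer_smul_left]
  have h2 : (totalOp Φ₀ Φ j * frameOp (Φ j))ᴴ = totalOp Φ₀ Φ j * frameOp (Φ j) := by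
    rw [h1, Matrix.conjTranspose_sum]
    refine Finset.sum_congr rfl fun i _ => ?_
    rw [Matrix.conjTranspose_smul, outer_self_isHermitian, Complex.star_def, Complex.conj_ofReal]
  rw [Matrix.conjTranspose_mul, frameOp_isHermitian, totalOp_isHermitian] at h2
  rw [totalOp, mul_add, add_mul] at h2
  exact (add_right_cancel h2).symm

theorem eigUp_eq_of_monotone {d : ℕ} {A : Matrix (Fin d) (Fin d) ℂ} (hA : A.IsHermitian)
    (v : OrthonormalBasis (Fin d) ℂ (EuclideanSpace ℂ (Fin d))) {x : Fin d → ℝ}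
    (hx : Monotone x) (h : ∀ i, A.toEuclideanLin (v i) = (x i : ℂ) • v i) : eigUp hA = x := by
  have h1 := eigDown_eq_downSort hA (v.reindex Fin.revPerm) (fun i => x i.rev) fun i => by
    simp only [OrthonormalBasis.reindex_apply]
    exact h i.rev
  rw [downSort_of_antitone fun a b hab => hx (Fin.rev_le_rev.mpr hab)] at h1
  funext i
  simp [eigUp, h1]

/-- At a local minimizer, the initial frame operators and those of the design are diagonal in
common orthonormal bases, with oppositely ordered spectra. -/
theorem exists_aligned_basis (hΦ : Φ ∈ designs α d)
    (hmin : IsLocalMinOn (jointPotential Φ₀) (designs α d) Φ) {c : Fin n → ℝ}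
    (hc : ∀ i j, (totalOp Φ₀ Φ j).toEuclideanLin (Φ j i) = (c i : ℂ) • Φ j i) (j : Fin m) :
    ∃ v : OrthonormalBasis (Fin (d j)) ℂ (EuclideanSpace ℂ (Fin (d j))), ∀ i,
      (frameOp (Φ₀ j)).toEuclideanLin (v i) =
        (eigUp (frameOp_isHermitian (Φ₀ j)) i : ℂ) • v i ∧
      (frameOp (Φ j)).toEuclideanLin (v i) =
        (eigDown (frameOp_isHermitian (Φ j)) i : ℂ) • v i := by
  obtain ⟨w, x, y, hw⟩ := exists_joint_eigenbasis (frameOp_isHermitian (Φ₀ j))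
    (frameOp_isHermitian (Φ j)) (commute_frameOp hc j)
  have hT : ∀ i, (totalOp Φ₀ Φ j).toEuclideanLin (w i) = ((x i + y i : ℝ) : ℂ) • w i := by
    intro i
    rw [totalOp, map_add, LinearMap.add_apply, (hw i).1, (hw i).2, ← add_smul,
      ← Complex.ofReal_add]
  have hy0 : ∀ i, 0 ≤ y i := fun i => frameOp_eigenvalue_nonneg (w.norm_eq_one i) (hw i).2
  -- If both `x` and `y` increased strictly from `i` to `i'`, the gap would read `y i + (x i' + y i'
  -- - x i - y i) ≤ y i'`, that is `x i' ≤ x i`.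
  have hanti : ∀ i i', x i < x i' → y i' ≤ y i := by
    intro i i' hlt
    by_contra! hlt'
    have := eigenvector_gap hΦ hmin hc (w.norm_eq_one i') (w.norm_eq_one i)
      (add_lt_add hlt hlt') (lt_of_le_of_lt (hy0 i) hlt') (hT i') (hT i) (hw i').2 (hw i).2
    linarith
  -- Sorting by the difference makes `x` monotone and `y` antitone at once, ties included.
  set σ := Tuple.sort fun i => x i - y i with hσ
  have hsort : ∀ a b, a ≤ b → x (σ a) - y (σ a) ≤ x (σ b) - y (σ b) := fun a b hab =>
    Tuple.monotone_sort (fun i => x i - y i) hab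
  have hxm : Monotone (x ∘ σ) := by
    intro a b hab
    by_contra! hlt
    have := hanti _ _ hlt
    have := hsort a b hab
    simp only [Function.comp] at *
    linarith
  have hym : Antitone (y ∘ σ) := by
    intro a b hab
    by_contra! hlt
    have h1 := hsort a b hab
    have h2 := hxm hab
    simp only [Function.comp] at *
    have := hanti (σ a) (σ b) (by linarith)
    linarith
  have hv1 : ∀ i, (frameOp (Φ₀ j)).toEuclideanLin (w.reindex σ.symm i) =
      ((x ∘ σ) i : ℂ) • w.reindex σ.symm i := fun i => by
    simpa only [OrthonormalBasis.reindex_apply, Equiv.symm_symm, Function.comp_apply]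
      using (hw (σ i)).1
  have hv2 : ∀ i, (frameOp (Φ j)).toEuclideanLin (w.reindex σ.symm i) =
      ((y ∘ σ) i : ℂ) • w.reindex σ.symm i := fun i => by
    simpa only [OrthonormalBasis.reindex_apply, Equiv.symm_symm, Function.comp_apply]
      using (hw (σ i)).2
  refine ⟨w.reindex σ.symm, fun i => ?_⟩
  rw [eigUp_eq_of_monotone _ _ hxm hv1, eigDown_eq_downSort _ _ _ hv2, downSort_of_antitone hym]
  exact ⟨hv1 i, hv2 i⟩

/-- The structure of local minimizers of the joint potential. -/
theorem structure_of_isLocalMinOn (hdn : ∀ j, d j ≤ n) (hα : ∀ i, 0 < α i) (hα' : Antitone α)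
    (hΦ : Φ ∈ designs α d) (hmin : IsLocalMinOn (jointPotential Φ₀) (designs α d) Φ) :
    ∃ c : Fin n → ℝ, Antitone c ∧ (∀ i, 0 ≤ c i) ∧
      (∀ i j, (totalOp Φ₀ Φ j).toEuclideanLin (Φ j i) = (c i : ℂ) • Φ j i) ∧
      ∀ j i, eigUp (frameOp_isHermitian (Φ₀ j)) i + eigDown (frameOp_isHermitian (Φ j)) i =
        max (c (Fin.castLE (hdn j) i)) (eigUp (frameOp_isHermitian (Φ₀ j)) i) := by
  classical
  choose c hc0 hc using exists_eigenvalue_of_isLocalMinOn hα hΦ hmin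
  have hca := antitone_eigenvalue hα hα' hΦ hmin hc
  refine ⟨c, hca, hc0, hc, fun j l => ?_⟩
  obtain ⟨v, hv⟩ := exists_aligned_basis hΦ hmin hc j
  set x := eigUp (frameOp_isHermitian (Φ₀ j)) with hx
  set y := eigDown (frameOp_isHermitian (Φ j)) with hy
  have hym : Antitone y := eigDown_antitone _
  have hT : ∀ i, (totalOp Φ₀ Φ j).toEuclideanLin (v i) = ((x i + y i : ℝ) : ℂ) • v i := by
    intro i
    rw [totalOp, map_add, LinearMap.add_apply, (hv i).1, (hv i).2, ← add_smul,
      ← Complex.ofReal_add]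
  have hy0 : ∀ i, 0 ≤ y i := fun i => frameOp_eigenvalue_nonneg (v.norm_eq_one i) (hv i).2
  have hgap : ∀ i i', x i' + y i' < x i + y i → 0 < y i → y i' < y i := by
    intro i i' hlt hpos
    have := eigenvector_gap hΦ hmin hc (v.norm_eq_one i) (v.norm_eq_one i') hlt hpos (hT i) (hT i')
      (hv i).2 (hv i').2
    linarith
  have hne : ∀ i i', ⟪v i', Φ j i⟫_ℂ ≠ 0 → c i = x i' + y i' ∧ 0 < y i' := by
    intro i i' hinner
    constructor
    · by_contra hcne
      exact hinner (inner_eq_zero_of_eigenvalue_ne (totalOp_isHermitian Φ₀ Φ j) (Ne.symm hcne)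
        (hT i') (hc i j))
    · refine lt_of_le_of_ne (hy0 i') fun h0 => hinner ?_
      have h1 := inner_frameOp (Φ j) (v i')
      rw [(hv i').2, ← h0, Complex.ofReal_zero, zero_smul, inner_zero_right, eq_comm,
        Complex.ofReal_eq_zero, Finset.sum_eq_zero_iff_of_nonneg fun i _ => by positivity] at h1
      have h2 := h1 i (Finset.mem_univ i)
      rwa [sq_eq_zero_iff, norm_inner_symm, norm_eq_zero] at h2
  -- Otherwise the first `l + 1` vectors are independent in block `j`. They lie in eigenspaces of
  -- larger total eigenvalue with `y > 0`; by the gap these are spanned by basis vectors of index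
  -- below `l`, which are only `l` many.
  have hlower : c (Fin.castLE (hdn j) l) ≤ x l + y l := by
    by_contra! hlt
    have hli := linearIndependent_of_isLocalMinOn hα hΦ hmin hc (v.norm_eq_one l) (hT l)
    have hspan : ∀ i : {i // x l + y l < c i}, Φ j i ∈
        Submodule.span ℂ (((Finset.Iio l).image v : Finset _) : Set _) := by
      rintro ⟨i, hi⟩
      rw [← v.sum_repr' (Φ j i)]
      refine Submodule.sum_mem _ fun i' _ => ?_
      by_cases hinner : ⟪v i', Φ j i⟫_ℂ = 0
      · rw [hinner, zero_smul]
        exact Submodule.zero_mem _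
      · obtain ⟨h1, h2⟩ := hne i i' hinner
        have h3 := hgap i' l (by linarith) h2
        refine Submodule.smul_mem _ _ (Submodule.subset_span ?_)
        simp only [Finset.coe_image, Finset.coe_Iio]
        exact ⟨i', Set.mem_Iio.mpr (not_le.mp fun h => absurd (hym h) (not_le.mpr h3)), rfl⟩
    have hcard := linearIndependent_le_span_aux' _ hli _ (Set.range_subset_iff.mpr hspan)
    simp only [Finset.coe_sort_coe, Fintype.card_coe] at hcard
    have h1 : ((Finset.Iio l).image v).card ≤ l := Finset.card_image_le.trans (by simp)
    have h2 : (l : ℕ) + 1 ≤ Fintype.card {i // x l + y l < c i} := by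
      rw [← Fin.card_Iic, Fintype.card_subtype, ← Finset.card_map (Fin.castLEEmb (hdn j))]
      refine Finset.card_le_card fun i hi => ?_
      obtain ⟨i', hi', rfl⟩ := Finset.mem_map.mp hi
      simp only [Finset.mem_filter, Finset.mem_univ, true_and]
      have hi'' : i' ≤ l := Finset.mem_Iic.mp hi'
      exact hlt.trans_le (hca hi'')
    omega
  -- The dual count: `v 0, …, v l` all have positive `y` and total eigenvalue at least that of `l`,
  -- so they lie in the span of the `Φ j i` with `c i > c l`, all of index below `l`.
  have hupper : 0 < y l → x l + y l ≤ c (Fin.castLE (hdn j) l) := by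
    intro hpos
    by_contra! hlt
    have hli : LinearIndependent ℂ fun i : {i // i ≤ l} => v i :=
      v.orthonormal.linearIndependent.comp _ Subtype.val_injective
    have hspan : ∀ i : {i // i ≤ l}, v i ∈
        Submodule.span ℂ (((Finset.Iio (Fin.castLE (hdn j) l)).image (Φ j) : Finset _) :
          Set _) := by
      rintro ⟨i', hi'⟩
      simp only
      have hpos' : 0 < y i' := hpos.trans_le (hym hi')
      have hge : x l + y l ≤ x i' + y i' := by
        by_contra! h
        exact absurd (hym hi') (not_le.mpr (hgap l i' h hpos))
      have h1 := toEuclideanLin_frameOp (Φ j) (v i')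
      rw [(hv i').2] at h1
      have h2 : v i' = ((y i' : ℝ) : ℂ)⁻¹ • ∑ i, ⟪Φ j i, v i'⟫_ℂ • Φ j i := by
        rw [← h1, smul_smul, inv_mul_cancel₀ (by exact_mod_cast hpos'.ne'), one_smul]
      rw [h2]
      refine Submodule.smul_mem _ _ (Submodule.sum_mem _ fun i _ => ?_)
      by_cases hinner : ⟪v i', Φ j i⟫_ℂ = 0
      · rw [← inner_conj_symm, hinner, map_zero, zero_smul]
        exact Submodule.zero_mem _
      · refine Submodule.smul_mem _ _ (Submodule.subset_span ?_)
        simp only [Finset.coe_image, Finset.coe_Iio]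
        refine ⟨i, Set.mem_Iio.mpr (not_le.mp fun h => ?_), rfl⟩
        have h3 := (hne i i' hinner).1
        have h4 := hca h
        linarith
    have hcard := linearIndependent_le_span_aux' _ hli _ (Set.range_subset_iff.mpr hspan)
    simp only [Finset.coe_sort_coe, Fintype.card_coe] at hcard
    have h1 : ((Finset.Iio (Fin.castLE (hdn j) l)).image (Φ j)).card ≤ l :=
      Finset.card_image_le.trans (by simp)
    have h2 : Fintype.card {i // i ≤ l} = l + 1 := by
      rw [Fintype.card_subtype, ← Fin.card_Iic]
      congr 1
      ext; simp
    omega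
  rcases (hy0 l).eq_or_lt with h0 | hpos
  · rw [← h0, add_zero] at hlower ⊢
    exact (max_eq_right hlower).symm
  · have := hupper hpos
    rw [max_eq_left (by linarith)]
    linarith

end Structure

/-! ### Local minimizers are global; uniqueness of the spectra. -/

section Optimality

variable {m k n : ℕ} {d : Fin m → ℕ} {α : Fin n → ℝ} {Φ₀ : Design d k} {Φ Φ' : Design d n}

theorem exists_total_eigenbasis (hα : ∀ i, 0 < α i) (hΦ : Φ ∈ designs α d)
    (hmin : IsLocalMinOn (jointPotential Φ₀) (designs α d) Φ) (j : Fin m) :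
    ∃ v : OrthonormalBasis (Fin (d j)) ℂ (EuclideanSpace ℂ (Fin (d j))), ∀ i,
      (frameOp (Φ₀ j)).toEuclideanLin (v i) =
        (eigUp (frameOp_isHermitian (Φ₀ j)) i : ℂ) • v i ∧
      (frameOp (Φ j)).toEuclideanLin (v i) =
        (eigDown (frameOp_isHermitian (Φ j)) i : ℂ) • v i ∧
      (totalOp Φ₀ Φ j).toEuclideanLin (v i) =
        ((eigUp (frameOp_isHermitian (Φ₀ j)) i + eigDown (frameOp_isHermitian (Φ j)) i : ℝ) : ℂ) •
          v i := by
  choose c _ hc using exists_eigenvalue_of_isLocalMinOn hα hΦ hmin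
  obtain ⟨v, hv⟩ := exists_aligned_basis hΦ hmin hc j
  refine ⟨v, fun i => ⟨(hv i).1, (hv i).2, ?_⟩⟩
  rw [totalOp, map_add, LinearMap.add_apply, (hv i).1, (hv i).2, ← add_smul, ← Complex.ofReal_add]

theorem jointPotential_eq_sum_of_isLocalMinOn (hα : ∀ i, 0 < α i) (hΦ : Φ ∈ designs α d)
    (hmin : IsLocalMinOn (jointPotential Φ₀) (designs α d) Φ) :
    jointPotential Φ₀ Φ = ∑ j, ∑ i, (eigUp (frameOp_isHermitian (Φ₀ j)) i +
      eigDown (frameOp_isHermitian (Φ j)) i) ^ 2 := by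
  rw [jointPotential_eq]
  refine Finset.sum_congr rfl fun j _ => ?_
  obtain ⟨v, hv⟩ := exists_total_eigenbasis hα hΦ hmin j
  exact trace_sq_of_eigen v _ fun i => (hv i).2.2

theorem trace_sq_eq_sum_eigDown {d : ℕ} {A : Matrix (Fin d) (Fin d) ℂ} (hA : A.IsHermitian) :
    (A * A).trace.re = ∑ i, eigDown hA i ^ 2 := by
  obtain ⟨u, hu⟩ := exists_eigDown_basis hA
  exact trace_sq_of_eigen u _ hu

/-- After expanding the square, only the cross term depends on the relative position of the two
operators, and it is smallest for oppositely ordered spectra. -/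
theorem sum_eigUp_add_eigDown_sq_le (Φ₀ : Design d k) (Φ : Design d n) :
    ∑ j, ∑ i, (eigUp (frameOp_isHermitian (Φ₀ j)) i +
      eigDown (frameOp_isHermitian (Φ j)) i) ^ 2 ≤ jointPotential Φ₀ Φ := by
  rw [jointPotential_eq]
  refine Finset.sum_le_sum fun j _ => ?_
  have h1 := sum_eigUp_mul_eigDown_le_trace (frameOp_isHermitian (Φ₀ j))
    (frameOp_isHermitian (Φ j)) (eigDown_frameOp_nonneg _)
  have h2 := trace_sq_eq_sum_eigDown (frameOp_isHermitian (Φ₀ j))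
  have h3 := trace_sq_eq_sum_eigDown (frameOp_isHermitian (Φ j))
  have h4 : ∑ i, eigDown (frameOp_isHermitian (Φ₀ j)) i ^ 2 =
      ∑ i, eigUp (frameOp_isHermitian (Φ₀ j)) i ^ 2 :=
    (Equiv.sum_comp Fin.revPerm fun i => eigDown (frameOp_isHermitian (Φ₀ j)) i ^ 2).symm
  rw [totalOp, add_mul, mul_add, mul_add, Matrix.trace_add, Matrix.trace_add, Matrix.trace_add,
    Matrix.trace_mul_comm (frameOp (Φ j)) (frameOp (Φ₀ j)), Complex.add_re, Complex.add_re,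
    Complex.add_re, h2, h3, h4]
  simp only [add_sq, Finset.sum_add_distrib, mul_assoc, ← Finset.mul_sum]
  linarith

/-- Local minimizers of the joint potential are global minimizers, quantitatively. -/
theorem jointPotential_add_sum_sq_le (hdn : ∀ j, d j ≤ n) (hα : ∀ i, 0 < α i) (hα' : Antitone α)
    (hΦ : Φ ∈ designs α d) (hmin : IsLocalMinOn (jointPotential Φ₀) (designs α d) Φ)
    (hΦ' : Φ' ∈ designs α d) :
    jointPotential Φ₀ Φ + ∑ j, ∑ i, (eigDown (frameOp_isHermitian (Φ' j)) i -
      eigDown (frameOp_isHermitian (Φ j)) i) ^ 2 ≤ jointPotential Φ₀ Φ' := by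
  obtain ⟨c, hca, hc0, hc, hmax⟩ := structure_of_isLocalMinOn hdn hα hα' hΦ hmin
  refine le_trans ?_ (sum_eigUp_add_eigDown_sq_le Φ₀ Φ')
  rw [jointPotential_eq_sum_of_isLocalMinOn hα hΦ hmin]
  set x := fun j => eigUp (frameOp_isHermitian (Φ₀ j)) with hx
  set y := fun j => eigDown (frameOp_isHermitian (Φ j)) with hy
  set y' := fun j => eigDown (frameOp_isHermitian (Φ' j)) with hy'
  have hy0 : ∀ j i, 0 ≤ y j i := fun j => eigDown_frameOp_nonneg _
  have hy0' : ∀ j i, 0 ≤ y' j i := fun j => eigDown_frameOp_nonneg _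
  -- Complementary slackness: where `y` is positive, the maximum is attained by `c`.
  have hmul : ∀ j i, y j i * (x j i + y j i) = y j i * c (Fin.castLE (hdn j) i) := by
    intro j i
    rcases (hy0 j i).eq_or_lt with h | h
    · rw [← h, zero_mul, zero_mul]
    · congr 1
      have h1 : x j i + y j i = max _ _ := hmax j i
      rcases max_choice (c (Fin.castLE (hdn j) i)) (x j i) with h2 | h2
      · exact h1.trans h2
      · linarith [h1.trans h2]
  -- For the minimizer the left side equals `∑ i, c i * α i`, since both compute the trace of `T_j
  -- S_{F_j}` summed over `j`. For the competitor majorization gives only an inequality.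
  have hlin : ∑ j, ∑ i, y j i * c (Fin.castLE (hdn j) i) ≤
      ∑ j, ∑ i, y' j i * c (Fin.castLE (hdn j) i) := by
    have hswap : ∀ {Ψ : Design d n}, Ψ ∈ designs α d →
        ∑ j, ∑ i, c i * ‖Ψ j i‖ ^ 2 = ∑ i, c i * α i := by
      intro Ψ hΨ
      rw [Finset.sum_comm]
      simp only [← Finset.mul_sum, hΨ _]
    calc ∑ j, ∑ i, y j i * c (Fin.castLE (hdn j) i) = ∑ j, ∑ i, c i * ‖Φ j i‖ ^ 2 := by
          refine Finset.sum_congr rfl fun j _ => ?_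
          obtain ⟨v, hv⟩ := exists_total_eigenbasis hα hΦ hmin j
          have h1 := trace_eq_sum_of_eigen v _ (fun i => (hv i).2.1) (totalOp Φ₀ Φ j)
          rw [trace_mul_frameOp] at h1
          simp only [hc, (hv _).2.2, inner_smul_right, inner_self_eq_norm_sq_to_K,
            v.norm_eq_one] at h1
          simp only [← hmul]
          have h2 : ((∑ i, c i * ‖Φ j i‖ ^ 2 : ℝ) : ℂ) =
              ((∑ i, y j i * (x j i + y j i) : ℝ) : ℂ) := by
            push_cast
            simpa using h1
          exact_mod_cast h2.symm
      _ = ∑ j, ∑ i, c i * ‖Φ' j i‖ ^ 2 := (hswap hΦ).trans (hswap hΦ').symm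
      _ ≤ _ := Finset.sum_le_sum fun j _ => sum_mul_norm_sq_le (hdn j) (Φ' j) hca hc0
  -- Expand `(x + y')²` around `x + y`. In the linear term `2 (y' - y)(x + y)`, use `x + y ≥ c`
  -- against `y' ≥ 0` and slackness against `y`.
  have hterm : ∀ j i, (x j i + y j i) ^ 2 + (y' j i - y j i) ^ 2 +
      2 * (y' j i * c (Fin.castLE (hdn j) i) - y j i * c (Fin.castLE (hdn j) i)) ≤
        (x j i + y' j i) ^ 2 := by
    intro j i
    have h1 : c (Fin.castLE (hdn j) i) ≤ x j i + y j i := (hmax j i).symm ▸ le_max_left _ _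
    nlinarith [mul_le_mul_of_nonneg_left h1 (hy0' j i), hmul j i]
  have hsum := Finset.sum_le_sum fun j (_ : j ∈ Finset.univ) =>
    Finset.sum_le_sum fun i (_ : i ∈ Finset.univ) => hterm j i
  simp only [Finset.sum_add_distrib, Finset.sum_sub_distrib, ← Finset.mul_sum] at hsum
  linarith

theorem isMinOn_of_isLocalMinOn (hdn : ∀ j, d j ≤ n) (hα : ∀ i, 0 < α i) (hα' : Antitone α)
    (hΦ : Φ ∈ designs α d) (hmin : IsLocalMinOn (jointPotential Φ₀) (designs α d) Φ) :
    IsMinOn (jointPotential Φ₀) (designs α d) Φ := fun Φ' hΦ' => by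
  have h1 := jointPotential_add_sum_sq_le hdn hα hα' hΦ hmin hΦ'
  have h2 : 0 ≤ ∑ j, ∑ i, (eigDown (frameOp_isHermitian (Φ' j)) i -
      eigDown (frameOp_isHermitian (Φ j)) i) ^ 2 :=
    Finset.sum_nonneg fun j _ => Finset.sum_nonneg fun i _ => sq_nonneg _
  show jointPotential Φ₀ Φ ≤ jointPotential Φ₀ Φ'
  linarith

/-- The frame operators of the local minimizers all have the same spectra. -/
theorem eigDown_eq_of_isLocalMinOn (hdn : ∀ j, d j ≤ n) (hα : ∀ i, 0 < α i) (hα' : Antitone α)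
    (hΦ : Φ ∈ designs α d) (hmin : IsLocalMinOn (jointPotential Φ₀) (designs α d) Φ)
    (hΦ' : Φ' ∈ designs α d) (hmin' : IsLocalMinOn (jointPotential Φ₀) (designs α d) Φ')
    (j : Fin m) (i : Fin (d j)) :
    eigDown (frameOp_isHermitian (Φ' j)) i = eigDown (frameOp_isHermitian (Φ j)) i := by
  have h1 := jointPotential_add_sum_sq_le hdn hα hα' hΦ hmin hΦ'
  have h2 : jointPotential Φ₀ Φ' ≤ jointPotential Φ₀ Φ :=
    isMinOn_of_isLocalMinOn hdn hα hα' hΦ' hmin' hΦ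
  have h3 : ∀ j ∈ Finset.univ, 0 ≤ ∑ i, (eigDown (frameOp_isHermitian (Φ' j)) i -
      eigDown (frameOp_isHermitian (Φ j)) i) ^ 2 :=
    fun j _ => Finset.sum_nonneg fun i _ => sq_nonneg _
  have h4 := (Finset.sum_eq_zero_iff_of_nonneg h3).mp
    (le_antisymm (by linarith) (Finset.sum_nonneg h3)) j (Finset.mem_univ j)
  have h5 := (Finset.sum_eq_zero_iff_of_nonneg fun i _ => sq_nonneg _).mp h4 i (Finset.mem_univ i)
  exact sub_eq_zero.mp (pow_eq_zero_iff two_ne_zero |>.mp h5)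

theorem card_filter_eq_of_downSort_eq {d : ℕ} {x y : Fin d → ℝ} (h : downSort x = downSort y)
    (t : ℝ) : (Finset.univ.filter fun i => t ≤ x i).card =
      (Finset.univ.filter fun i => t ≤ y i).card := by
  have h1 : Finset.univ.val.map x = Finset.univ.val.map y := by
    rw [← map_downSort x, h, map_downSort]
  have h2 := congrArg (Multiset.countP fun s => t ≤ s) h1
  rw [Multiset.countP_map, Multiset.countP_map] at h2
  exact h2

theorem le_of_downSort_eq {d : ℕ} {x c c' ν ν' : Fin d → ℝ} (hc : Antitone c)
    (hc' : Antitone c') (hν : ∀ i, ν i = max (c i) (x i)) (hν' : ∀ i, ν' i = max (c' i) (x i))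
    (h : downSort ν = downSort ν') (i : Fin d) : ν' i ≤ ν i := by
  by_contra! hlt
  have hci' : ν' i = c' i := by
    rcases max_choice (c' i) (x i) with h2 | h2
    · rw [hν', h2]
    · have := le_max_right (c i) (x i)
      rw [← hν] at this
      rw [hν', h2] at hlt
      linarith
  -- With `t = ν' i = c' i`, the set `{ν ≥ t}` is strictly inside `{ν' ≥ t}`. Up to `i`, `c'` is at
  -- least `t`; beyond `i`, `c` is below `t`, so `ν ≥ t` must come from the common `x`. The index
  -- `i` makes it strict.
  refine absurd (card_filter_eq_of_downSort_eq h (ν' i)) (ne_of_lt (Finset.card_lt_card ?_))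
  rw [Finset.ssubset_iff_of_subset]
  · exact ⟨i, by simp, by simpa using hlt⟩
  · intro l hl
    simp only [Finset.mem_filter, Finset.mem_univ, true_and] at hl ⊢
    rcases le_or_gt l i with hli | hli
    · rw [hci', hν' l]
      exact (hc' hli).trans (le_max_left _ _)
    · have h1 : c l < ν' i := lt_of_le_of_lt ((hc hli.le).trans (hν i ▸ le_max_left _ _)) hlt
      rw [hν l] at hl
      rw [hν' l]
      rcases le_max_iff.mp hl with h2 | h2
      · exact absurd h2 (not_le.mpr h1)
      · exact le_max_of_le_right h2

/-- A vector of the form `max (c, x)` with non-increasing `c` is determined by its non-increasing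
rearrangement. -/
theorem eq_of_downSort_eq {d : ℕ} {x c c' ν ν' : Fin d → ℝ} (hc : Antitone c)
    (hc' : Antitone c') (hν : ∀ i, ν i = max (c i) (x i)) (hν' : ∀ i, ν' i = max (c' i) (x i))
    (h : downSort ν = downSort ν') (i : Fin d) : ν i = ν' i :=
  le_antisymm (le_of_downSort_eq hc' hc hν' hν h.symm i) (le_of_downSort_eq hc hc' hν hν' h i)

theorem eigDown_completion_of_isLocalMinOn (hα : ∀ i, 0 < α i) (hΦ : Φ ∈ designs α d)
    (hmin : IsLocalMinOn (jointPotential Φ₀) (designs α d) Φ) (j : Fin m) :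
    eigDown (frameOp_isHermitian (completion Φ₀ Φ j)) = downSort fun i =>
      eigUp (frameOp_isHermitian (Φ₀ j)) i + eigDown (frameOp_isHermitian (Φ j)) i := by
  obtain ⟨v, hv⟩ := exists_total_eigenbasis hα hΦ hmin j
  refine eigDown_eq_downSort _ v _ fun i => ?_
  rw [frameOp_completion]
  exact (hv i).2.2

theorem isOptimalSpectra_of_isLocalMinOn [NeZero m] (hd : Antitone d) (hdn : d 0 ≤ n)
    (hα : ∀ i, 0 < α i) (hα' : Antitone α) (hΦ : Φ ∈ designs α d)
    (hmin : IsLocalMinOn (jointPotential Φ₀) (designs α d) Φ) :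
    IsOptimalSpectra hd α Φ₀ fun j i =>
      eigUp (frameOp_isHermitian (Φ₀ j)) i + eigDown (frameOp_isHermitian (Φ j)) i := by
  obtain ⟨c, hca, -, -, hmax⟩ :=
    structure_of_isLocalMinOn (fun j => (hd (Fin.zero_le j)).trans hdn) hα hα' hΦ hmin
  exact ⟨⟨Φ, hΦ, hmin, eigDown_completion_of_isLocalMinOn hα hΦ hmin⟩,
    fun i => c (Fin.castLE hdn i), fun a b h => hca h, hmax⟩

/-- The minimizer behind `ν` may differ from `Φ`, but both have the same frame spectra, so the
sorted lists agree; the form `max (c, x)` then fixes the order. -/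
theorem IsOptimalSpectra.eq_of_isLocalMinOn [NeZero m] {hd : Antitone d} (hdn : d 0 ≤ n)
    (hα : ∀ i, 0 < α i) (hα' : Antitone α) (hΦ : Φ ∈ designs α d)
    (hmin : IsLocalMinOn (jointPotential Φ₀) (designs α d) Φ)
    {ν : (j : Fin m) → Fin (d j) → ℝ} (hν : IsOptimalSpectra hd α Φ₀ ν) (j : Fin m)
    (i : Fin (d j)) :
    ν j i = eigUp (frameOp_isHermitian (Φ₀ j)) i + eigDown (frameOp_isHermitian (Φ j)) i := by
  obtain ⟨⟨Φ', hΦ', hmin', hspec⟩, c, hca, hmax⟩ := hν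
  obtain ⟨-, c', hca', hmax'⟩ := isOptimalSpectra_of_isLocalMinOn hd hdn hα hα' hΦ hmin
  refine eq_of_downSort_eq (x := eigUp (frameOp_isHermitian (Φ₀ j)))
    (c := fun i => c (Fin.castLE (hd (Fin.zero_le j)) i))
    (c' := fun i => c' (Fin.castLE (hd (Fin.zero_le j)) i))
    (fun a b h => hca h) (fun a b h => hca' h) (hmax j) (hmax' j) ?_ i
  rw [← hspec j, eigDown_completion_of_isLocalMinOn hα hΦ' hmin' j]
  congr 1
  funext i
  rw [eigDown_eq_of_isLocalMinOn (fun j => (hd (Fin.zero_le j)).trans hdn) hα hα' hΦ hmin hΦ' hmin']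

end Optimality

/-! ### Existence of minimizers and of translated designs. -/

section Existence

variable {m k n : ℕ} {d : Fin m → ℕ} {α : Fin n → ℝ}

theorem continuous_jointPotential (Φ₀ : Design d k) :
    Continuous (jointPotential (n := n) Φ₀) := by
  have h : (jointPotential (n := n) Φ₀) = fun Φ => ∑ j,
      (totalOp Φ₀ Φ j * totalOp Φ₀ Φ j).trace.re := funext fun Φ => jointPotential_eq Φ₀ Φ
  rw [h]
  refine continuous_finsetSum _ fun j _ => Complex.continuous_re.comp ?_
  have hc : Continuous fun Φ : Design d n => totalOp Φ₀ Φ j :=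
    continuous_const.add (continuous_frameOp.comp (continuous_apply j))
  exact (hc.matrix_mul hc).matrix_trace

theorem isCompact_designs (α : Fin n → ℝ) (d : Fin m → ℕ) : IsCompact (designs α d) := by
  refine IsCompact.of_isClosed_subset
    (isCompact_univ_pi fun j => isCompact_univ_pi fun i =>
      isCompact_closedBall (0 : EuclideanSpace ℂ (Fin (d j))) √(α i)) ?_ ?_
  · simp only [designs, Set.ofPred_forall]
    exact isClosed_iInter fun i => isClosed_eq (by fun_prop) continuous_const
  · intro Φ hΦ j _ i _
    rw [mem_closedBall_zero_iff]
    refine Real.le_sqrt_of_sq_le ?_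
    rw [← hΦ i]
    exact Finset.single_le_sum (f := fun j => ‖Φ j i‖ ^ 2) (fun j _ => by positivity)
      (Finset.mem_univ j)

theorem designs_nonempty [NeZero m] (hd0 : 0 < d 0) (hα : ∀ i, 0 < α i) :
    (designs α d).Nonempty := by
  refine ⟨Function.update 0 0 fun i => EuclideanSpace.single ⟨0, hd0⟩ ((√(α i) : ℝ) : ℂ),
    fun i => ?_⟩
  rw [Finset.sum_eq_single 0]
  · simp [Real.sq_sqrt (hα i).le]
  · intro j _ hj
    simp [hj]
  · simp

theorem exists_isLocalMinOn [NeZero m] (hd0 : 0 < d 0) (hα : ∀ i, 0 < α i) (Φ₀ : Design d k) :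
    ∃ Φ ∈ designs α d, IsLocalMinOn (jointPotential Φ₀) (designs α d) Φ := by
  obtain ⟨Φ, hΦ, hmin⟩ := (isCompact_designs α d).exists_isMinOn (designs_nonempty hd0 hα)
    (continuous_jointPotential Φ₀).continuousOn
  exact ⟨Φ, hΦ, hmin.localize⟩

theorem le_maxNorm (Φ₀ : Design d k) (j : Fin m) :
    ‖Matrix.toEuclideanCLM (𝕜 := ℂ) (frameOp (Φ₀ j))‖ ≤ maxNorm Φ₀ :=
  le_ciSup (f := fun j => ‖Matrix.toEuclideanCLM (𝕜 := ℂ) (frameOp (Φ₀ j))‖)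
    (Set.finite_range _).bddAbove j

theorem exists_isTranslated [NeZero m] (hd : Antitone d) (Φ₀ : Design d k) :
    ∃ Φt : Design d (d 0), IsTranslated Φ₀ Φt := by
  choose v hv using fun j => exists_eigDown_basis (frameOp_isHermitian (Φ₀ j))
  have hle : ∀ j i, eigDown (frameOp_isHermitian (Φ₀ j)) i ≤ maxNorm Φ₀ := by
    intro j i
    have h1 := (Matrix.toEuclideanCLM (𝕜 := ℂ) (frameOp (Φ₀ j))).le_opNorm (v j i)
    have h2 : Matrix.toEuclideanCLM (𝕜 := ℂ) (frameOp (Φ₀ j)) (v j i) =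
      (eigDown (frameOp_isHermitian (Φ₀ j)) i : ℂ) • v j i := hv j i
    rw [h2, norm_smul, (v j).norm_eq_one, mul_one, mul_one, Complex.norm_real] at h1
    exact (le_abs_self _).trans (h1.trans (le_maxNorm Φ₀ j))
  let f : (j : Fin m) → Fin (d j) → EuclideanSpace ℂ (Fin (d j)) := fun j i =>
    ((√(maxNorm Φ₀ - eigDown (frameOp_isHermitian (Φ₀ j)) i) : ℝ) : ℂ) • v j i
  -- All blocks need the same length, so the `d j` vectors `√(M - λ_i) v_i` are padded with zeros up
  -- to length `d 0`.
  refine ⟨fun j i => if h : (i : ℕ) < d j then f j ⟨i, h⟩ else 0, fun j => ?_⟩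
  have h1 : frameOp (fun i : Fin (d 0) => if h : (i : ℕ) < d j then f j ⟨i, h⟩ else 0) =
      ∑ i, outer (f j i) (f j i) := by
    refine (Fintype.sum_of_injective (Fin.castLE (hd (Fin.zero_le j)))
      (Fin.castLE_injective _) _ _ ?_ ?_).symm
    · intro i hi
      have hi' : ¬ (i : ℕ) < d j := fun h => hi ⟨⟨i, h⟩, rfl⟩
      simp [hi']
    · intro i
      simp
  rw [h1, eq_sum_outer_of_eigen (v j) (fun i => maxNorm Φ₀ -
    eigDown (frameOp_isHermitian (Φ₀ j)) i) (A := _ - frameOp (Φ₀ j)) fun i => ?_]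
  · refine Finset.sum_congr rfl fun i _ => ?_
    rw [outer_smul_left, outer_smul_right, Complex.star_def, Complex.conj_ofReal, smul_smul,
      ← Complex.ofReal_mul, Real.mul_self_sqrt (sub_nonneg.mpr (hle j i))]
  · rw [map_sub, LinearMap.sub_apply, hv, map_smul, LinearMap.smul_apply, Complex.ofReal_sub,
      sub_smul]
    simp

end Existence

/-! ### From the potential back to the frame operator distance. -/

section Distance

variable {m k l n : ℕ} {d : Fin m → ℕ} {α : Fin n → ℝ} {Φ₀ : Design d k} {Φt : Design d l}
  {Φ : Design d n}

theorem IsTranslated.sub_eq (ht : IsTranslated Φ₀ Φt) (Φ : Design d n) (j : Fin m) :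
    frameOp (Φ₀ j) - frameOp (Φ j) =
      ((maxNorm Φ₀ : ℝ) : ℂ) • (1 : Matrix (Fin (d j)) (Fin (d j)) ℂ) - totalOp Φt Φ j := by
  rw [totalOp, ht j]
  abel

/-- On the designs with prescribed weights, the joint frame operator distance and the joint
potential of the completions of a translated design differ by a constant. -/
theorem IsTranslated.exists_jfod_eq (ht : IsTranslated Φ₀ Φt) (α : Fin n → ℝ) :
    ∃ K : ℝ, ∀ Φ ∈ designs α d, jfod Φ₀ Φ = jointPotential Φt Φ + K := by
  set M := maxNorm Φ₀ with hM
  refine ⟨∑ j, (M ^ 2 * d j - 2 * M * (frameOp (Φt j)).trace.re) - 2 * M * ∑ i, α i,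
    fun Φ hΦ => ?_⟩
  have h1 : ∀ j, frobSq (frameOp (Φ₀ j) - frameOp (Φ j)) =
      (totalOp Φt Φ j * totalOp Φt Φ j).trace.re +
        (M ^ 2 * d j - 2 * M * (frameOp (Φt j)).trace.re) - 2 * M * ∑ i, ‖Φ j i‖ ^ 2 := by
    intro j
    rw [frobSq_eq_trace ((frameOp_isHermitian _).sub (frameOp_isHermitian _)), ht.sub_eq,
      sub_mul, mul_sub, mul_sub, smul_mul_smul_comm, smul_mul_assoc, mul_smul_comm, one_mul,
      one_mul, mul_one, Matrix.trace_sub, Matrix.trace_sub, Matrix.trace_sub, Matrix.trace_smul,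
      Matrix.trace_smul, Matrix.trace_one, smul_eq_mul, smul_eq_mul, ← Complex.ofReal_mul,
      Complex.sub_re, Complex.sub_re, Complex.sub_re, Complex.re_ofReal_mul,
      Complex.re_ofReal_mul]
    conv_lhs => enter [1, 2, 2]; rw [totalOp]
    conv_lhs => enter [2, 1, 2]; rw [totalOp]
    rw [Matrix.trace_add, trace_frameOp (Φ j), Complex.add_re, Complex.ofReal_re]
    simp
    ring
  rw [jfod, jointPotential_eq, Finset.sum_congr rfl fun j _ => h1 j, Finset.sum_sub_distrib,
    Finset.sum_add_distrib, ← Finset.mul_sum, Finset.sum_comm]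
  rw [Finset.sum_congr rfl fun i _ => hΦ i]
  ring

theorem frobSq_eq_of_eigDown_eq {d : ℕ} {A : Matrix (Fin d) (Fin d) ℂ} (hA : A.IsHermitian)
    {δ : Fin d → ℝ} (h : eigDown hA = downSort δ) : frobSq A = ∑ i, δ i ^ 2 := by
  obtain ⟨σ, hσ⟩ := downSort_eq_comp_perm δ
  rw [frobSq_eq_trace hA, trace_sq_eq_sum_eigDown hA, h, hσ]
  exact Equiv.sum_comp σ fun i => δ i ^ 2

/-- The basis aligned for `Φt` and `Φ` also diagonalizes `frameOp (Φ₀ j)`. The reflection `t ↦ M -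
t` turns the increasing spectrum of the translate into the decreasing one of `Φ₀`, so the indices
match without reordering. -/
theorem IsTranslated.eigen_sub (hα : ∀ i, 0 < α i) (ht : IsTranslated Φ₀ Φt)
    (hΦ : Φ ∈ designs α d) (hmin : IsLocalMinOn (jointPotential Φt) (designs α d) Φ)
    (j : Fin m) :
    (eigDown ((frameOp_isHermitian (Φ₀ j)).sub (frameOp_isHermitian (Φ j))) =
      downSort fun i => maxNorm Φ₀ - (eigUp (frameOp_isHermitian (Φt j)) i +
        eigDown (frameOp_isHermitian (Φ j)) i)) ∧
    ∃ v : OrthonormalBasis (Fin (d j)) ℂ (EuclideanSpace ℂ (Fin (d j))),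
      frameOp (Φ₀ j) = ∑ i, ((eigDown (frameOp_isHermitian (Φ₀ j)) i : ℝ) : ℂ) •
        outer (v i) (v i) ∧
      frameOp (Φ j) = ∑ i, ((eigDown (frameOp_isHermitian (Φ₀ j)) i - (maxNorm Φ₀ -
        (eigUp (frameOp_isHermitian (Φt j)) i + eigDown (frameOp_isHermitian (Φ j)) i)) : ℝ) : ℂ) •
          outer (v i) (v i) := by
  obtain ⟨v, hv⟩ := exists_total_eigenbasis hα hΦ hmin j
  have hscal : ∀ z : EuclideanSpace ℂ (Fin (d j)),
      (((maxNorm Φ₀ : ℝ) : ℂ) • (1 : Matrix (Fin (d j)) (Fin (d j)) ℂ)).toEuclideanLin z =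
        ((maxNorm Φ₀ : ℝ) : ℂ) • z := by
    intro z
    rw [map_smul, LinearMap.smul_apply]
    simp
  have hS0 : ∀ i, (frameOp (Φ₀ j)).toEuclideanLin (v i) =
      ((maxNorm Φ₀ - eigUp (frameOp_isHermitian (Φt j)) i : ℝ) : ℂ) • v i := by
    intro i
    have h1 : frameOp (Φ₀ j) = ((maxNorm Φ₀ : ℝ) : ℂ) • 1 - frameOp (Φt j) := by
      rw [ht j]; abel
    rw [h1, map_sub, LinearMap.sub_apply, hscal, (hv i).1, ← sub_smul, ← Complex.ofReal_sub]
  have hup : Monotone (eigUp (frameOp_isHermitian (Φt j))) := fun a b h =>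
    eigDown_antitone _ (Fin.rev_le_rev.mpr h)
  have hdown : eigDown (frameOp_isHermitian (Φ₀ j)) = fun i =>
      maxNorm Φ₀ - eigUp (frameOp_isHermitian (Φt j)) i := by
    rw [eigDown_eq_downSort _ v _ hS0, downSort_of_antitone]
    exact fun a b h => sub_le_sub_left (hup h) _
  refine ⟨eigDown_eq_downSort _ v _ fun i => ?_, v, ?_, ?_⟩
  · rw [ht.sub_eq, map_sub, LinearMap.sub_apply, hscal, (hv i).2.2, ← sub_smul,
      ← Complex.ofReal_sub]
  · exact eq_sum_outer_of_eigen v _ fun i => by rw [hdown]; exact hS0 i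
  · refine eq_sum_outer_of_eigen v _ fun i => ?_
    rw [hdown, (hv i).2.1]
    congr 2
    ring

theorem IsTranslated.isLocalMinOn_iff (ht : IsTranslated Φ₀ Φt) (hΦ : Φ ∈ designs α d) :
    IsLocalMinOn (jfod Φ₀) (designs α d) Φ ↔
      IsLocalMinOn (jointPotential Φt) (designs α d) Φ := by
  obtain ⟨K, hK⟩ := ht.exists_jfod_eq α
  refine eventually_congr (eventually_mem_nhdsWithin.mono fun Ψ hΨ => ?_)
  rw [hK Φ hΦ, hK Ψ hΨ, add_le_add_iff_right]

theorem IsTranslated.isMinOn_of_isLocalMinOn (hdn : ∀ j, d j ≤ n) (hα : ∀ i, 0 < α i)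
    (hα' : Antitone α) (ht : IsTranslated Φ₀ Φt) (hΦ : Φ ∈ designs α d)
    (hmin : IsLocalMinOn (jfod Φ₀) (designs α d) Φ) : IsMinOn (jfod Φ₀) (designs α d) Φ := by
  obtain ⟨K, hK⟩ := ht.exists_jfod_eq α
  intro Ψ hΨ
  have : jointPotential Φt Φ ≤ jointPotential Φt Ψ :=
    MultiDesign.isMinOn_of_isLocalMinOn hdn hα hα' hΦ ((ht.isLocalMinOn_iff hΦ).mp hmin) hΨ
  show jfod Φ₀ Φ ≤ jfod Φ₀ Ψ
  rw [hK Φ hΦ, hK Ψ hΨ]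
  linarith

end Distance

end MultiDesign

/-! ### The main theorem. -/

open MultiDesign in
theorem theorem3p4 {m n k : ℕ} [NeZero m] (d : Fin m → ℕ) (hd : Antitone d)
    (hdpos : ∀ j, 0 < d j) (hdn : d 0 ≤ n)
    (α : Fin n → ℝ) (hα : Antitone α) (hαpos : ∀ i, 0 < α i) (Φ₀ : Design d k) :
    (∃ (l : ℕ) (Φt : Design d l), IsTranslated Φ₀ Φt) ∧
    (∀ (l : ℕ) (Φt : Design d l), IsTranslated Φ₀ Φt →
      (∃! ν : (j : Fin m) → Fin (d j) → ℝ, IsOptimalSpectra hd α Φt ν) ∧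
      ∀ ν : (j : Fin m) → Fin (d j) → ℝ, IsOptimalSpectra hd α Φt ν →
        ∀ δ : (j : Fin m) → Fin (d j) → ℝ, (∀ j i, δ j i = maxNorm Φ₀ - ν j i) →
          IsLeast (jfod Φ₀ '' designs α d) (∑ j, ∑ i, δ j i ^ 2) ∧
          ∀ Φ ∈ designs α d,
            (jfod Φ₀ Φ = ∑ j, ∑ i, δ j i ^ 2 ↔
              ∀ j, eigDown ((frameOp_isHermitian (Φ₀ j)).sub (frameOp_isHermitian (Φ j))) =
                downSort (δ j)) ∧
            (jfod Φ₀ Φ = ∑ j, ∑ i, δ j i ^ 2 →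
              ∀ j, ∃ v : OrthonormalBasis (Fin (d j)) ℂ (EuclideanSpace ℂ (Fin (d j))),
                frameOp (Φ₀ j) =
                  ∑ i, ((eigDown (frameOp_isHermitian (Φ₀ j)) i : ℝ) : ℂ) • outer (v i) (v i) ∧
                frameOp (Φ j) =
                  ∑ i, ((eigDown (frameOp_isHermitian (Φ₀ j)) i - δ j i : ℝ) : ℂ) •
                    outer (v i) (v i))) ∧
    (∀ Φ ∈ designs α d, IsLocalMinOn (jfod Φ₀) (designs α d) Φ →
      IsMinOn (jfod Φ₀) (designs α d) Φ) := by
  have hdn' : ∀ j, d j ≤ n := fun j => (hd (Fin.zero_le j)).trans hdn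
  obtain ⟨Φ₁, h₁⟩ := exists_isTranslated hd Φ₀
  refine ⟨⟨_, Φ₁, h₁⟩, fun l Φt ht => ?_, fun Φ hΦ hmin =>
    h₁.isMinOn_of_isLocalMinOn hdn' hαpos hα hΦ hmin⟩
  obtain ⟨Φm, hΦm, hmin⟩ := exists_isLocalMinOn (hdpos 0) hαpos Φt
  refine ⟨⟨_, isOptimalSpectra_of_isLocalMinOn hd hdn hαpos hα hΦm hmin, fun ν hν =>
    funext fun j => funext fun i => hν.eq_of_isLocalMinOn hdn hαpos hα hΦm hmin j i⟩,
    fun ν hν δ hδ => ?_⟩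
  have key : ∀ Φ ∈ designs α d, IsLocalMinOn (jointPotential Φt) (designs α d) Φ → ∀ j,
      (eigDown ((frameOp_isHermitian (Φ₀ j)).sub (frameOp_isHermitian (Φ j))) =
        downSort (δ j)) ∧
      ∃ v : OrthonormalBasis (Fin (d j)) ℂ (EuclideanSpace ℂ (Fin (d j))),
        frameOp (Φ₀ j) =
          ∑ i, ((eigDown (frameOp_isHermitian (Φ₀ j)) i : ℝ) : ℂ) • outer (v i) (v i) ∧
        frameOp (Φ j) =
          ∑ i, ((eigDown (frameOp_isHermitian (Φ₀ j)) i - δ j i : ℝ) : ℂ) •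
            outer (v i) (v i) := by
    intro Φ hΦ hloc j
    have hδj : δ j = fun i => maxNorm Φ₀ - (eigUp (frameOp_isHermitian (Φt j)) i +
        eigDown (frameOp_isHermitian (Φ j)) i) := funext fun i => by
      rw [hδ, hν.eq_of_isLocalMinOn hdn hαpos hα hΦ hloc]
    rw [hδj]
    exact ht.eigen_sub hαpos hΦ hloc j
  have hval : ∀ Φ : Design d n,
      (∀ j, eigDown ((frameOp_isHermitian (Φ₀ j)).sub (frameOp_isHermitian (Φ j))) =
        downSort (δ j)) → jfod Φ₀ Φ = ∑ j, ∑ i, δ j i ^ 2 := fun Φ h =>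
    Finset.sum_congr rfl fun j _ => frobSq_eq_of_eigDown_eq _ (h j)
  have hΦm_val := hval Φm fun j => (key Φm hΦm hmin j).1
  have hΦm_min := h₁.isMinOn_of_isLocalMinOn hdn' hαpos hα hΦm ((ht.isLocalMinOn_iff hΦm).mpr hmin)
  -- A design attaining the value is a minimizer of the distance, hence a local minimizer of the
  -- potential, so the spectral description in `key` applies to it.
  have hloc : ∀ Φ ∈ designs α d, jfod Φ₀ Φ = ∑ j, ∑ i, δ j i ^ 2 →
      IsLocalMinOn (jointPotential Φt) (designs α d) Φ := fun Φ hΦ h => by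
    refine (ht.isLocalMinOn_iff hΦ).mp (IsMinOn.localize fun Ψ hΨ => ?_)
    show jfod Φ₀ Φ ≤ jfod Φ₀ Ψ
    rw [h, ← hΦm_val]
    exact hΦm_min hΨ
  refine ⟨⟨⟨Φm, hΦm, hΦm_val⟩, ?_⟩, fun Φ hΦ =>
    ⟨⟨fun h j => (key Φ hΦ (hloc Φ hΦ h) j).1, hval Φ⟩,
      fun h j => (key Φ hΦ (hloc Φ hΦ h) j).2⟩⟩
  rintro _ ⟨Φ, hΦ, rfl⟩
  rw [← hΦm_val]
  exact hΦm_min hΦ
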